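/- Let $\mathfrak g$ be a finite-dimensional complex simple Lie algebra, $\mathfrak h\subset\mathfrak g$ a Cartan subalgebra, $\alpha_1,\dots,\alpha_l$ a system of simple roots, $H_1,\dots,H_l\in\mathfrak h$ the corresponding simple coroots, $a_{ij}=\alpha_j(H_i)$ the Cartan matrix, and $d_1,\dots,d_l$ the coprime positive integers such that the matrix $(d_ia_{ij})$ is symmetric. Let $(\cdot,\cdot)$ be the bilinear form on $\mathfrak h^*$ with $(\alpha_i,\alpha_j)=d_ia_{ij}$. Let $s$ be an element of the Weyl group, acting naturally on $\mathfrak h^*$; let $\mathfrak h'^*\subset\mathfrak h^*$ be the orthogonal complement, with respect to the Killing form, of the subspace of vectors fixed by $s$, and $P_{\mathfrak h'^*}$ the orthogonal projection onto it. On $\mathfrak h'^*$ the operator $1-s$ is invertible; put $$c_{ij}=\Big(\tfrac{1+s}{1-s}P_{\mathfrak h'^*}\alpha_i,\ \alpha_j\Big).$$ Let $q=e^h$, $q^z=e^{hz}$ for $z\in\mathbb C$, $q_i=q^{d_i}$, $K_i=e^{d_ihH_i}$, $[n]_t=\frac{t^n-t^{-n}}{t-t^{-1}}$, and let $\left[{m\atop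 r}\right]_t$ be the corresponding $t$-binomial coefficients. An algebra over $\mathbb C[[h]]$ topologically generated by given generators with given defining relations is the quotient of the $h$-adic completion of the free $\mathbb C[[h]]$-algebra on the generators by the $h$-adic closure of the two-sided ideal generated by the relations. The standard quantum group $U_h(\mathfrak g)$ is the algebra over $\mathbb C[[h]]$ topologically generated by $H_i,X_i^+,X_i^-$, $i=1,\dots,l$, with defining relations $$[H_i,H_j]=0,\quad [H_i,X_j^\pm]=\pm a_{ij}X_j^\pm,\quad X_i^+X_j^--X_j^-X_i^+=\delta_{ij}\frac{K_i-K_i^{-1}}{q_i-q_i^{-1}},$$ $$\sum_{r=0}^{1-a_{ij}}(-1)^r\left[{1-a_{ij}\atop r}\right]_{q_i}(X_i^\pm)^{1-a_{ij}-r}X_j^\pm(X_i^\pm)^r=0\quad(i\ne j).$$ The realization $U_h^s(\mathfrak g)$ is the algebra over $\mathbb C[[h]]$ topologically generated by $H_i,e_i,f_i$, $i=1,\dots,l$, with defining relations $$[H_i,H_j]=0,\quad [H_i,e_j]=a_{ij}e_j,\quad [H_i,f_j]=-a_{ij}f_j,\quad e_if_j-q^{-c_{ij}}f_je_i=\delta_{ij}\frac{K_i-K_i^{-1}}{q_i-q_i^{-1}},$$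 $$\sum_{r=0}^{1-a_{ij}}(-1)^rq^{rc_{ij}}\left[{1-a_{ij}\atop r}\right]_{q_i}e_i^{1-a_{ij}-r}e_je_i^r=0,\quad \sum_{r=0}^{1-a_{ij}}(-1)^rq^{rc_{ij}}\left[{1-a_{ij}\atop r}\right]_{q_i}f_i^{1-a_{ij}-r}f_jf_i^r=0\quad(i\ne j).$$ In $U_h(\mathfrak g)$ put $Y_i=\sum_{j=1}^l d_i(a^{-1})_{ij}H_j$, $L_i=e^{hY_i}$, and $L_i^z=e^{hzY_i}$ for $z\in\mathbb C$; these elements commute with each other. **Theorem.** For all $n_{ij}\in\mathbb C$, $i,j=1,\dots,l$, with $$d_jn_{ij}-d_in_{ji}=c_{ij}\qquad\text{for all } i,j,$$ there is a unique isomorphism of $\mathbb C[[h]]$-algebras $\psi:U_h^s(\mathfrak g)\to U_h(\mathfrak g)$ such that for all $i$ $$\psi(e_i)=X_i^+\prod_{p=1}^lL_p^{n_{ip}},\qquad \psi(f_i)=\prod_{p=1}^lL_p^{-n_{ip}}\,X_i^-,\qquad \psi(H_i)=H_i.$$ -/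

import Mathlib

open Module LieAlgebra LieAlgebra.IsKilling
open scoped PowerSeries

noncomputable section

namespace QuantumRealization

/-- The subspace of fixed vectors of `σ`. -/
def fixedSubspace {V : Type*} [AddCommGroup V] [Module ℂ V] (σ : V →ₗ[ℂ] V) : Submodule ℂ V :=
  LinearMap.ker (1 - σ)

theorem mem_fixedSubspace {V : Type*} [AddCommGroup V] [Module ℂ V] (σ : V →ₗ[ℂ] V) (x : V) :
    x ∈ fixedSubspace σ ↔ σ x = x := by
  rw [fixedSubspace, LinearMap.mem_ker, LinearMap.sub_apply, Module.End.one_apply, sub_eq_zero,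
    eq_comm]

theorem isCompl_fixedSubspace {V : Type*} [AddCommGroup V] [Module ℂ V] [FiniteDimensional ℂ V]
    (B : LinearMap.BilinForm ℂ V) (σ : V →ₗ[ℂ] V) (hB : B.IsSymm) (hB' : B.Nondegenerate)
    (hσ : ∀ x y, B (σ x) (σ y) = B x y) (k : ℕ) (hk : 0 < k) (hσk : σ ^ k = 1) :
    IsCompl (B.orthogonal (fixedSubspace σ)) (fixedSubspace σ) := by
  refine (LinearMap.BilinForm.isCompl_orthogonal_of_restrict_nondegenerate hB.isRefl ?_).symm
  have key : ∀ x ∈ fixedSubspace σ, (∀ y ∈ fixedSubspace σ, B x y = 0) → x = 0 := by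
    intro x hx h
    refine hB'.1 x fun v => ?_
    have hx' : ∀ m : ℕ, (σ ^ m) x = x := by
      intro m
      induction m with
      | zero => simp
      | succ m ih => rw [pow_succ, Module.End.mul_apply, (mem_fixedSubspace σ x).1 hx, ih]
    have hm : ∀ m : ℕ, ∀ u w, B ((σ ^ m) u) ((σ ^ m) w) = B u w := by
      intro m
      induction m with
      | zero => simp
      | succ m ih => intro u w; rw [pow_succ', Module.End.mul_apply, Module.End.mul_apply, hσ, ih]
    have hv : ∑ m ∈ Finset.range k, (σ ^ m) v ∈ fixedSubspace σ := by
      rw [mem_fixedSubspace, map_sum]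
      simp_rw [← Module.End.mul_apply, ← pow_succ']
      have := Finset.sum_range_succ' (fun m => (σ ^ m) v) k
      rw [Finset.sum_range_succ, hσk, pow_zero] at this
      exact (add_right_cancel this).symm
    have h1 := h _ hv
    rw [map_sum, Finset.sum_congr rfl (g := fun _ => B x v)] at h1
    · simpa [hk.ne'] using h1
    · intro m _
      conv_lhs => rw [← hx' m]
      exact hm m x v
  have hrefl : (B.restrict (fixedSubspace σ)).IsRefl := fun x y h => hB.isRefl x y h
  refine (LinearMap.IsRefl.nondegenerate_iff_separatingLeft hrefl).2 fun x hx => ?_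
  exact Subtype.ext (key x x.2 fun y hy => hx ⟨y, hy⟩)

theorem one_sub_mem_orthogonal {V : Type*} [AddCommGroup V] [Module ℂ V]
    (B : LinearMap.BilinForm ℂ V) (σ : V →ₗ[ℂ] V)
    (hσ : ∀ x y, B (σ x) (σ y) = B x y) (x : V) (hx : x ∈ B.orthogonal (fixedSubspace σ)) :
    (1 - σ) x ∈ B.orthogonal (fixedSubspace σ) := by
  intro y hy
  have h1 : B y x = 0 := hx y hy
  have h2 : B y (σ x) = 0 := by
    conv_lhs => rw [← (mem_fixedSubspace σ y).1 hy]
    rw [hσ, h1]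
  change B y (x - σ x) = 0
  rw [map_sub, h1, h2, sub_zero]

/-! ### Cartan data -/

section Lie

variable {𝔤 : Type*} [LieRing 𝔤] [LieAlgebra ℂ 𝔤] [FiniteDimensional ℂ 𝔤]
  [LieAlgebra.IsSimple ℂ 𝔤] {𝔥 : LieSubalgebra ℂ 𝔤} [𝔥.IsCartanSubalgebra]

variable (𝔥) in
/-- The Killing form, transported from `𝔥` to `𝔥*` by the isomorphism that it induces. -/
def dualKillingForm : LinearMap.BilinForm ℂ (Dual ℂ 𝔥) :=
  ((killingForm ℂ 𝔤).restrict 𝔥.toSubmodule).compl₁₂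
    (cartanEquivDual 𝔥).symm.toLinearMap (cartanEquivDual 𝔥).symm.toLinearMap

theorem dualKillingForm_apply (x y : Dual ℂ 𝔥) :
    dualKillingForm 𝔥 x y = x ((cartanEquivDual 𝔥).symm y) := by
  have : cartanEquivDual 𝔥 ((cartanEquivDual 𝔥).symm x) ((cartanEquivDual 𝔥).symm y) =
    x ((cartanEquivDual 𝔥).symm y) := by rw [LinearEquiv.apply_symm_apply]
  rw [← this]
  rfl

theorem dualKillingForm_isSymm : (dualKillingForm 𝔥).IsSymm := by
  constructor
  intro x y
  exact LieModule.traceForm_comm ℂ 𝔤 𝔤 _ _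

theorem dualKillingForm_nondegenerate : (dualKillingForm 𝔥).Nondegenerate := by
  refine (LinearMap.IsRefl.nondegenerate_iff_separatingLeft
    (dualKillingForm_isSymm (𝔥 := 𝔥)).isRefl).2 fun x hx => ?_
  ext h
  simpa [dualKillingForm_apply] using hx (cartanEquivDual 𝔥 h)

/-- The natural action on `𝔥*` of an element of the Weyl group. -/
def weylAct (s : (rootSystem 𝔥).weylGroup) : Dual ℂ 𝔥 →ₗ[ℂ] Dual ℂ 𝔥 :=
  (rootSystem 𝔥).weylGroupRootRep s

theorem weylAct_pow (s : (rootSystem 𝔥).weylGroup) :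
    ∃ k, 0 < k ∧ weylAct s ^ k = 1 := by
  obtain ⟨k, hk, hk'⟩ := (isOfFinOrder_of_finite ((rootSystem 𝔥).weylGroupToPerm s)).exists_pow_eq_one
  refine ⟨k, hk, ?_⟩
  rw [weylAct, ← map_pow]
  refine LinearMap.ext_on_range (v := (rootSystem 𝔥).root)
    (by simp) fun i => ?_
  have := (rootSystem 𝔥).weylGroup_apply_root (s ^ k) i
  rw [map_pow, hk'] at this
  exact this

theorem dualKillingForm_reflection (i : 𝔥.root) (x y : Dual ℂ 𝔥) :
    dualKillingForm 𝔥 ((rootSystem 𝔥).reflection i x) ((rootSystem 𝔥).reflection i y) =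
      dualKillingForm 𝔥 x y := by
  set α : Dual ℂ 𝔥 := (i : LieModule.Weight ℂ 𝔥 𝔤).toLinear with hα
  have hne : α ((cartanEquivDual 𝔥).symm α) ≠ 0 :=
    root_apply_cartanEquivDual_symm_ne_zero (Finset.mem_filter.1 i.2).2
  have hco : ∀ z : Dual ℂ 𝔥, z ((rootSystem 𝔥).coroot i) =
      2 * (dualKillingForm 𝔥 α α)⁻¹ * dualKillingForm 𝔥 z α := by
    intro z
    simp only [rootSystem_coroot_apply, coroot, dualKillingForm_apply]
    simp [mul_assoc, hα]
  have hne' : dualKillingForm 𝔥 α α ≠ 0 := by rwa [dualKillingForm_apply]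
  have hr : ∀ z : Dual ℂ 𝔥, (rootSystem 𝔥).reflection i z =
      z - (2 * (dualKillingForm 𝔥 α α)⁻¹ * dualKillingForm 𝔥 z α) • α := by
    intro z
    rw [RootPairing.reflection_apply, ← hco]
    rfl
  have hs : dualKillingForm 𝔥 α y = dualKillingForm 𝔥 y α := dualKillingForm_isSymm.eq α y
  rw [hr, hr]
  simp only [map_sub, map_smul, LinearMap.sub_apply, LinearMap.smul_apply, smul_eq_mul, hs]
  field_simp
  ring

theorem dualKillingForm_weylAct (s : (rootSystem 𝔥).weylGroup) (x y : Dual ℂ 𝔥) :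
    dualKillingForm 𝔥 (weylAct s x) (weylAct s y) = dualKillingForm 𝔥 x y := by
  let F : (rootSystem 𝔥).InvariantForm :=
    { form := dualKillingForm 𝔥
      symm := LinearMap.BilinForm.isSymm_iff.1 dualKillingForm_isSymm
      ne_zero := fun i => by
        rw [dualKillingForm_apply]
        exact root_apply_cartanEquivDual_symm_ne_zero (Finset.mem_filter.1 i.2).2
      isOrthogonal_reflection := fun i x y => dualKillingForm_reflection i x y }
  exact RootPairing.InvariantForm.apply_weylGroup_smul (rootSystem 𝔥) (B := F) s x y

/-- The subspace `𝔥'*` of `𝔥*`: the orthogonal complement, with respect to the Killing form, of the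
subspace of vectors fixed by `s`. -/
def hPrimeDual (s : (rootSystem 𝔥).weylGroup) : Submodule ℂ (Dual ℂ 𝔥) :=
  (dualKillingForm 𝔥).orthogonal (fixedSubspace (weylAct s))

theorem isCompl_hPrimeDual (s : (rootSystem 𝔥).weylGroup) :
    IsCompl (hPrimeDual s) (fixedSubspace (weylAct s)) := by
  obtain ⟨k, hk, hk'⟩ := weylAct_pow s
  exact isCompl_fixedSubspace _ _ dualKillingForm_isSymm dualKillingForm_nondegenerate
    (dualKillingForm_weylAct s) k hk hk'

/-- The orthogonal projection of `𝔥*` onto `𝔥'*`. -/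
def projHPrime (s : (rootSystem 𝔥).weylGroup) : Dual ℂ 𝔥 →ₗ[ℂ] hPrimeDual s :=
  (hPrimeDual s).projectionOnto (fixedSubspace (weylAct s)) (isCompl_hPrimeDual s)

/-- The restriction of `1 - s` to `𝔥'*`, which is invertible since `s` has no non-zero fixed
vectors there. -/
def oneSubHPrime (s : (rootSystem 𝔥).weylGroup) : hPrimeDual s ≃ₗ[ℂ] hPrimeDual s :=
  LinearEquiv.ofInjectiveEndo
    ((1 - weylAct s).restrict
      (one_sub_mem_orthogonal (dualKillingForm 𝔥) (weylAct s) (dualKillingForm_weylAct s)))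
    (by
      rw [← LinearMap.ker_eq_bot, LinearMap.ker_eq_bot']
      intro x hx
      have h1 : (x : Dual ℂ 𝔥) ∈ fixedSubspace (weylAct s) := congrArg Subtype.val hx
      exact Subtype.ext ((Submodule.disjoint_def.1 (isCompl_hPrimeDual s).disjoint) x x.2 h1))

/-- The endomorphism `((1 + s) / (1 - s)) P` of `𝔥*`, where `P` is the orthogonal projection onto
`𝔥'*` and the Cayley transform is that of the restriction of `s` to `𝔥'*`. -/
def cayley (s : (rootSystem 𝔥).weylGroup) : Dual ℂ 𝔥 →ₗ[ℂ] Dual ℂ 𝔥 :=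
  (1 + weylAct s) ∘ₗ (hPrimeDual s).subtype ∘ₗ (oneSubHPrime s).symm.toLinearMap ∘ₗ projHPrime s

/-- The Cartan matrix `a i j = α_j (H_i)`, where `H_i` is the simple coroot of `α_i`; it is the
transpose of Mathlib's `RootPairing.Base.cartanMatrix`, whose entries are `α_i (H_j)`. -/
def cartan (b : (rootSystem 𝔥).Base) : Matrix b.support b.support ℤ :=
  b.cartanMatrix.transpose

/-- The invariant bilinear form on `𝔥*` given by `(α_i, α_j) = d_i a_ij`. -/
def dualForm (b : (rootSystem 𝔥).Base) (d : b.support → ℕ) : LinearMap.BilinForm ℂ (Dual ℂ 𝔥) := by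
  classical
  exact Matrix.toBilin b.toWeightBasis (Matrix.of fun i j => (d i : ℂ) * (cartan b i j : ℂ))

/-- `c_ij = (((1 + s) / (1 - s)) P α_i, α_j)`. -/
def cayleyCoeff (b : (rootSystem 𝔥).Base) (d : b.support → ℕ) (s : (rootSystem 𝔥).weylGroup)
    (i j : b.support) : ℂ :=
  dualForm b d (cayley s ((rootSystem 𝔥).root i)) ((rootSystem 𝔥).root j)

end Lie

/-! ### Formal power series in `h` with coefficients in a complex algebra -/

section Series

variable {A : Type*} [Ring A]

/-- The series `e^{ha} = ∑ hⁿ aⁿ / n!`; the variable `X` of the power series is `h`. -/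
def expH [Algebra ℂ A] (a : A) : A⟦X⟧ := PowerSeries.mk fun n => ((n.factorial : ℂ)⁻¹) • a ^ n

theorem coeff_expH [Algebra ℂ A] (a : A) (n : ℕ) :
    PowerSeries.coeff n (expH a) = ((n.factorial : ℂ)⁻¹) • a ^ n := PowerSeries.coeff_mk _ _

/-- Division by `h`, for series without constant term. -/
def divH (f : A⟦X⟧) : A⟦X⟧ := PowerSeries.mk fun n => PowerSeries.coeff (n + 1) f

theorem X_mul_divH (f : A⟦X⟧) (hf : PowerSeries.coeff 0 f = 0) : PowerSeries.X * divH f = f := by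
  ext n
  cases n with
  | zero => rw [PowerSeries.coeff_zero_X_mul, hf]
  | succ n => rw [PowerSeries.coeff_succ_X_mul, divH, PowerSeries.coeff_mk]

theorem expH_mul_of_commute [Algebra ℂ A] (a b : A) (hab : Commute a b) : expH a * expH b = expH (a + b) := by
  ext n
  rw [PowerSeries.coeff_mul, coeff_expH, hab.add_pow', Finset.smul_sum]
  refine Finset.sum_congr rfl fun p hp => ?_
  rw [coeff_expH, coeff_expH, smul_mul_smul_comm, ← Nat.cast_smul_eq_nsmul ℂ, smul_smul]
  congr 1
  have h := Finset.HasAntidiagonal.mem_antidiagonal.1 hp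
  have h2 := Nat.add_choose_mul_factorial_mul_factorial p.1 p.2
  rw [← Nat.choose_symm_add, h] at h2
  have h3 : (n.choose p.1 : ℂ) * p.1.factorial * p.2.factorial = n.factorial := by
    exact_mod_cast h2
  rw [← h3]
  have h4 : (p.1.factorial : ℂ) ≠ 0 := by exact_mod_cast p.1.factorial_ne_zero
  have h5 : (p.2.factorial : ℂ) ≠ 0 := by exact_mod_cast p.2.factorial_ne_zero
  have h6 : (n.choose p.1 : ℂ) ≠ 0 := by
    exact_mod_cast (Nat.choose_pos (by omega : p.1 ≤ n)).ne'
  field_simp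

theorem expH_zero [Algebra ℂ A] : expH (0 : A) = 1 := by
  ext n
  rw [coeff_expH, PowerSeries.coeff_one]
  cases n <;> simp

/-- `q^z = e^{hz}`. -/
def qPow (z : ℂ) : ℂ⟦X⟧ := expH z

/-- The `q`-integer `[n]_{q^d} = (q^{dn} - q^{-dn}) / (q^d - q^{-d})`, for `d > 0`. Numerator and
denominator are divisible by `h`, and after division by `h` the denominator is invertible. -/
def qInt (d n : ℕ) : ℂ⟦X⟧ :=
  divH (qPow (d * n) - qPow (-(d * n))) * (divH (qPow d - qPow (-d)))⁻¹

/-- The `q`-factorial `[n]_{q^d}!`. -/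
def qFactorial (d n : ℕ) : ℂ⟦X⟧ := ∏ k ∈ Finset.range n, qInt d (k + 1)

/-- The `q`-binomial coefficient at `q^d`; the denominator is invertible in `ℂ[[h]]`. -/
def qBinom (d m r : ℕ) : ℂ⟦X⟧ := qFactorial d m * (qFactorial d r * qFactorial d (m - r))⁻¹

theorem constantCoeff_divH_qPow (z : ℂ) :
    PowerSeries.constantCoeff (divH (qPow z - qPow (-z))) = 2 * z := by
  rw [← PowerSeries.coeff_zero_eq_constantCoeff_apply, divH, PowerSeries.coeff_mk, map_sub, qPow,
    qPow, coeff_expH, coeff_expH]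
  simp
  ring

theorem qPow_mul_qInt (d n : ℕ) (hd : 0 < d) :
    (qPow d - qPow (-d)) * qInt d n = qPow (d * n) - qPow (-(d * n)) := by
  have h0 : ∀ z : ℂ, PowerSeries.X * divH (qPow z - qPow (-z)) = qPow z - qPow (-z) := by
    intro z
    apply X_mul_divH
    rw [map_sub, qPow, qPow, coeff_expH, coeff_expH]
    simp
  have h1 : divH (qPow (d : ℂ) - qPow (-d)) * (divH (qPow (d : ℂ) - qPow (-d)))⁻¹ = 1 := by
    apply PowerSeries.mul_inv_cancel
    rw [constantCoeff_divH_qPow]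
    have : (d : ℂ) ≠ 0 := by exact_mod_cast hd.ne'
    simpa using this
  rw [← h0 d, ← h0 (d * n), qInt]
  calc _ = PowerSeries.X * divH (qPow (d * n : ℂ) - qPow (-(d * n))) *
      (divH (qPow (d : ℂ) - qPow (-d)) * (divH (qPow (d : ℂ) - qPow (-d)))⁻¹) := by ring
    _ = _ := by rw [h1, mul_one]

end Series

/-! ### Algebras over `ℂ[[h]]` topologically generated by generators and relations -/

section Presentation

/-- Labels of the generators: `H_i`, and `X_i^+`, `X_i^-` (respectively `e_i`, `f_i`). -/
inductive Gen (ι : Type*)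
  | cartan (i : ι) : Gen ι
  | pos (i : ι) : Gen ι
  | neg (i : ι) : Gen ι

/-- The `h`-adic completion of the free `ℂ[[h]]`-algebra on the generators: power series in the
central variable `h` whose coefficients are noncommutative polynomials. -/
abbrev FreeTop (ι : Type*) : Type _ := (FreeAlgebra ℂ (Gen ι))⟦X⟧

variable {ι : Type*}

instance : Algebra ℂ⟦X⟧ (FreeTop ι) :=
  RingHom.toAlgebra' (PowerSeries.map (algebraMap ℂ (FreeAlgebra ℂ (Gen ι)))) (by
    intro f x
    ext n
    rw [PowerSeries.coeff_mul, PowerSeries.coeff_mul, ← Finset.Nat.sum_antidiagonal_swap]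
    refine Finset.sum_congr rfl fun p _ => ?_
    rw [PowerSeries.coeff_map, PowerSeries.coeff_map]
    exact Algebra.commutes _ _)

theorem smul_freeTop_def (f : ℂ⟦X⟧) (x : FreeTop ι) :
    f • x = PowerSeries.map (algebraMap ℂ (FreeAlgebra ℂ (Gen ι))) f * x := rfl

/-- A generator, in the free algebra. -/
def gen (g : Gen ι) : FreeAlgebra ℂ (Gen ι) := FreeAlgebra.ι ℂ g

/-- A generator, in the completed free algebra. -/
def genT (g : Gen ι) : FreeTop ι := PowerSeries.C (gen g)

/-- The closure of a two-sided ideal in the `h`-adic topology, in which the series divisible by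
`h^N`, `N ≥ 0`, are a base of neighbourhoods of zero. -/
def hClosure (I : TwoSidedIdeal (FreeTop ι)) : TwoSidedIdeal (FreeTop ι) :=
  TwoSidedIdeal.mk'
    {x | ∀ N : ℕ, ∃ y ∈ I, ∀ k < N, PowerSeries.coeff k x = PowerSeries.coeff k y}
    (fun _ => ⟨0, I.zero_mem, fun _ _ => rfl⟩)
    (by
      intro x y hx hy N
      obtain ⟨u, hu, hu'⟩ := hx N
      obtain ⟨v, hv, hv'⟩ := hy N
      exact ⟨u + v, I.add_mem hu hv, fun k hk => by rw [map_add, map_add, hu' k hk, hv' k hk]⟩)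
    (by
      intro x hx N
      obtain ⟨u, hu, hu'⟩ := hx N
      exact ⟨-u, I.neg_mem hu, fun k hk => by rw [map_neg, map_neg, hu' k hk]⟩)
    (by
      intro x y hy N
      obtain ⟨v, hv, hv'⟩ := hy N
      refine ⟨x * v, I.mul_mem_left _ _ hv, fun k hk => ?_⟩
      rw [PowerSeries.coeff_mul, PowerSeries.coeff_mul]
      refine Finset.sum_congr rfl fun p hp => ?_
      have := Finset.HasAntidiagonal.mem_antidiagonal.1 hp
      rw [hv' p.2 (by omega)])
    (by
      intro x y hx N
      obtain ⟨u, hu, hu'⟩ := hx N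
      refine ⟨u * y, I.mul_mem_right _ _ hu, fun k hk => ?_⟩
      rw [PowerSeries.coeff_mul, PowerSeries.coeff_mul]
      refine Finset.sum_congr rfl fun p hp => ?_
      have := Finset.HasAntidiagonal.mem_antidiagonal.1 hp
      rw [hu' p.1 (by omega)])

/-- The algebra over `ℂ[[h]]` topologically generated by the generators, with defining relations
`x = 0` for `x ∈ R`: the quotient of the completed free algebra by the `h`-adic closure of the
two-sided ideal generated by `R`. -/
abbrev TopPresented (R : Set (FreeTop ι)) : Type _ :=
  (hClosure (TwoSidedIdeal.span R)).ringCon.Quotient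

/-- The projection from the completed free algebra. -/
def toTopPresented (R : Set (FreeTop ι)) : FreeTop ι →+* TopPresented R :=
  (hClosure (TwoSidedIdeal.span R)).ringCon.mk'

theorem toTopPresented_eq_iff (R : Set (FreeTop ι)) (x y : FreeTop ι) :
    toTopPresented R x = toTopPresented R y ↔ x - y ∈ hClosure (TwoSidedIdeal.span R) := by
  rw [← TwoSidedIdeal.rel_iff]
  exact (hClosure (TwoSidedIdeal.span R)).ringCon.eq

theorem commute_expH (R : Set (FreeTop ι)) (a b : FreeAlgebra ℂ (Gen ι))
    (hab : (PowerSeries.C (a * b - b * a) : FreeTop ι) ∈ TwoSidedIdeal.span R) :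
    Commute (toTopPresented R (expH a)) (toTopPresented R (expH b)) := by
  set I := TwoSidedIdeal.span R
  have hpow : ∀ m n : ℕ, (PowerSeries.C (a ^ m * b ^ n - b ^ n * a ^ m) : FreeTop ι) ∈ I := by
    intro m n
    have h1 : Commute (I.ringCon.mk' (PowerSeries.C a)) (I.ringCon.mk' (PowerSeries.C b)) := by
      have := (I.rel_iff _ _).2 (by simpa using hab :
        (PowerSeries.C a * PowerSeries.C b - PowerSeries.C b * PowerSeries.C a : FreeTop ι) ∈ I)
      have := I.ringCon.eq.2 this
      exact this
    have h2 := h1.pow_pow m n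
    rw [← map_pow, ← map_pow, ← map_pow, ← map_pow] at h2
    have h3 : I.ringCon.mk' (PowerSeries.C (a ^ m) * PowerSeries.C (b ^ n)) =
      I.ringCon.mk' (PowerSeries.C (b ^ n) * PowerSeries.C (a ^ m)) := by
      rw [map_mul, map_mul]; exact h2
    have h4 := (I.rel_iff _ _).1 (I.ringCon.eq.1 h3)
    simpa using h4
  have key : ∀ N : ℕ, ∃ y ∈ I, ∀ k < N,
      PowerSeries.coeff k (expH a * expH b - expH b * expH a) = PowerSeries.coeff k y := by
    intro N
    let E : FreeAlgebra ℂ (Gen ι) → FreeTop ι := fun u =>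
      ∑ n ∈ Finset.range N, PowerSeries.monomial n (((n.factorial : ℂ)⁻¹) • u ^ n)
    have hE : ∀ u, ∀ k < N, PowerSeries.coeff k (E u) = PowerSeries.coeff k (expH u) := by
      intro u k hk
      simp only [E, map_sum, PowerSeries.coeff_monomial, coeff_expH]
      rw [Finset.sum_ite_eq, if_pos (Finset.mem_range.2 hk)]
    refine ⟨E a * E b - E b * E a, ?_, fun k hk => ?_⟩
    · simp only [E, Finset.sum_mul_sum]
      rw [Finset.sum_comm (s := Finset.range N) (t := Finset.range N)
        (f := fun i j => PowerSeries.monomial i (((i.factorial : ℂ)⁻¹) • b ^ i) *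
          PowerSeries.monomial j (((j.factorial : ℂ)⁻¹) • a ^ j)), ← Finset.sum_sub_distrib]
      refine I.finsetSum_mem _ _ fun i _ => ?_
      rw [← Finset.sum_sub_distrib]
      refine I.finsetSum_mem _ _ fun j _ => ?_
      rw [PowerSeries.monomial_mul_monomial, PowerSeries.monomial_mul_monomial, add_comm j i,
        ← map_sub, smul_mul_smul_comm, smul_mul_smul_comm, mul_comm ((j.factorial : ℂ)⁻¹),
        ← smul_sub]
      have := I.mul_mem_left (PowerSeries.monomial (i + j)
        (algebraMap ℂ (FreeAlgebra ℂ (Gen ι)) ((i.factorial : ℂ)⁻¹ * (j.factorial : ℂ)⁻¹))) _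
        (hpow i j)
      rwa [← PowerSeries.monomial_zero_eq_C_apply, PowerSeries.monomial_mul_monomial, add_zero,
        ← Algebra.smul_def] at this
    · rw [map_sub, map_sub]
      simp only [PowerSeries.coeff_mul]
      congr 1 <;>
      · refine Finset.sum_congr rfl fun p hp => ?_
        have := Finset.HasAntidiagonal.mem_antidiagonal.1 hp
        rw [hE _ p.1 (by omega), hE _ p.2 (by omega)]
  rw [commute_iff_eq, ← map_mul, ← map_mul, toTopPresented_eq_iff]
  exact (TwoSidedIdeal.mem_mk' _ _ _ _ _ _ _).2 key

end Presentation

/-! ### The quantum group and its realizations -/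

section Quantum

variable {ι : Type*}

/-- The series `(K_i - K_i⁻¹) / (q_i - q_i⁻¹)`, where `K_i = e^{d_i h H_i}` and `q_i = q^{d_i}`.
Numerator and denominator are divided by `h`, after which the denominator is invertible. -/
def cartanQuotient (d : ι → ℕ) (i : ι) : FreeTop ι :=
  (divH (qPow (d i) - qPow (-(d i))))⁻¹ •
    divH (expH ((d i : ℂ) • gen (Gen.cartan i)) - expH (-((d i : ℂ) • gen (Gen.cartan i))))

theorem smul_cartanQuotient (d : ι → ℕ) (i : ι) (hd : 0 < d i) :
    (qPow (d i) - qPow (-(d i))) • cartanQuotient d i =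
      expH ((d i : ℂ) • gen (Gen.cartan i)) - expH (-((d i : ℂ) • gen (Gen.cartan i))) := by
  have h0 : PowerSeries.X * divH (qPow (d i) - qPow (-(d i))) = qPow (d i) - qPow (-(d i)) := by
    apply X_mul_divH
    rw [map_sub, qPow, qPow, coeff_expH, coeff_expH]
    simp
  have h1 : divH (qPow (d i) - qPow (-(d i))) * (divH (qPow (d i) - qPow (-(d i))))⁻¹ = 1 := by
    apply PowerSeries.mul_inv_cancel
    rw [constantCoeff_divH_qPow]
    have : (d i : ℂ) ≠ 0 := by exact_mod_cast hd.ne'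
    simpa using this
  rw [← h0, cartanQuotient, smul_smul, mul_assoc, h1, mul_one, smul_freeTop_def, PowerSeries.map_X]
  apply X_mul_divH
  rw [map_sub, coeff_expH, coeff_expH]
  simp

open Classical in
/-- The left-hand sides of the defining relations `x = 0` of the standard quantum group, with
generators `H_i`, `X_i^+`, `X_i^-`, for a Cartan matrix `a` symmetrized by `d`. -/
inductive StandardRelator (a : Matrix ι ι ℤ) (d : ι → ℕ) : FreeTop ι → Prop
  | cartan_cartan (i j : ι) : StandardRelator a d
      (genT (.cartan i) * genT (.cartan j) - genT (.cartan j) * genT (.cartan i))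
  | cartan_pos (i j : ι) : StandardRelator a d
      (genT (.cartan i) * genT (.pos j) - genT (.pos j) * genT (.cartan i)
        - a i j • genT (.pos j))
  | cartan_neg (i j : ι) : StandardRelator a d
      (genT (.cartan i) * genT (.neg j) - genT (.neg j) * genT (.cartan i)
        + a i j • genT (.neg j))
  | pos_neg (i j : ι) : StandardRelator a d
      (genT (.pos i) * genT (.neg j) - genT (.neg j) * genT (.pos i)
        - if i = j then cartanQuotient d i else 0)
  | serre_pos (i j : ι) (hij : i ≠ j) : StandardRelator a d
      (∑ r ∈ Finset.range ((1 - a i j).toNat + 1),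
        ((-1) ^ r * qBinom (d i) (1 - a i j).toNat r) •
          (genT (.pos i) ^ ((1 - a i j).toNat - r) * genT (.pos j) * genT (.pos i) ^ r))
  | serre_neg (i j : ι) (hij : i ≠ j) : StandardRelator a d
      (∑ r ∈ Finset.range ((1 - a i j).toNat + 1),
        ((-1) ^ r * qBinom (d i) (1 - a i j).toNat r) •
          (genT (.neg i) ^ ((1 - a i j).toNat - r) * genT (.neg j) * genT (.neg i) ^ r))

open Classical in
/-- The left-hand sides of the defining relations `x = 0` of the realization of the quantum group
with deformation parameters `c`, with generators `H_i`, `e_i`, `f_i`. The factor `q^{r c_ij}` in the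
deformed Serre relations goes together with `e_i f_j - q^{-c_ij} f_j e_i`, where the exponent equals
`c_ji` when `c` is skew-symmetric. -/
inductive DeformedRelator (a : Matrix ι ι ℤ) (d : ι → ℕ) (c : ι → ι → ℂ) : FreeTop ι → Prop
  | cartan_cartan (i j : ι) : DeformedRelator a d c
      (genT (.cartan i) * genT (.cartan j) - genT (.cartan j) * genT (.cartan i))
  | cartan_pos (i j : ι) : DeformedRelator a d c
      (genT (.cartan i) * genT (.pos j) - genT (.pos j) * genT (.cartan i)
        - a i j • genT (.pos j))
  | cartan_neg (i j : ι) : DeformedRelator a d c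
      (genT (.cartan i) * genT (.neg j) - genT (.neg j) * genT (.cartan i)
        + a i j • genT (.neg j))
  | pos_neg (i j : ι) : DeformedRelator a d c
      (genT (.pos i) * genT (.neg j) - qPow (-c i j) • (genT (.neg j) * genT (.pos i))
        - if i = j then cartanQuotient d i else 0)
  | serre_pos (i j : ι) (hij : i ≠ j) : DeformedRelator a d c
      (∑ r ∈ Finset.range ((1 - a i j).toNat + 1),
        ((-1) ^ r * qPow (r * c i j) * qBinom (d i) (1 - a i j).toNat r) •
          (genT (.pos i) ^ ((1 - a i j).toNat - r) * genT (.pos j) * genT (.pos i) ^ r))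
  | serre_neg (i j : ι) (hij : i ≠ j) : DeformedRelator a d c
      (∑ r ∈ Finset.range ((1 - a i j).toNat + 1),
        ((-1) ^ r * qPow (r * c i j) * qBinom (d i) (1 - a i j).toNat r) •
          (genT (.neg i) ^ ((1 - a i j).toNat - r) * genT (.neg j) * genT (.neg i) ^ r))

/-- The standard quantum group attached to the Cartan matrix `a`, as an algebra. -/
abbrev StandardQG (a : Matrix ι ι ℤ) (d : ι → ℕ) : Type _ :=
  TopPresented {x | StandardRelator a d x}

/-- The realization with deformation parameters `c` of the quantum group attached to `a`. -/
abbrev DeformedQG (a : Matrix ι ι ℤ) (d : ι → ℕ) (c : ι → ι → ℂ) : Type _ :=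
  TopPresented {x | DeformedRelator a d c x}

variable [Fintype ι]

open Classical in
/-- The weight-type generator `Y_i = ∑_j d_i (a⁻¹)_ij H_j`. -/
def weightGen (a : Matrix ι ι ℤ) (d : ι → ℕ) (i : ι) : FreeAlgebra ℂ (Gen ι) :=
  ∑ j, ((d i : ℂ) * (a.map (Int.cast : ℤ → ℂ))⁻¹ i j) • gen (Gen.cartan j)

/-- The complex power `L_i^z = e^{h z Y_i}` of `L_i = e^{h Y_i}`, in the standard quantum group. -/
def weightExp (a : Matrix ι ι ℤ) (d : ι → ℕ) (i : ι) (z : ℂ) : StandardQG a d :=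
  toTopPresented _ (expH (z • weightGen a d i))

theorem commute_weightExp (a : Matrix ι ι ℤ) (d : ι → ℕ) (i j : ι) (z w : ℂ) :
    Commute (weightExp a d i z) (weightExp a d j w) := by
  classical
  apply commute_expH
  have h : ∀ p r : ι, (PowerSeries.C (gen (Gen.cartan p) * gen (Gen.cartan r) -
      gen (Gen.cartan r) * gen (Gen.cartan p)) : FreeTop ι) ∈
      TwoSidedIdeal.span {x | StandardRelator a d x} := by
    intro p r
    rw [map_sub, map_mul, map_mul]
    exact TwoSidedIdeal.subset_span (StandardRelator.cartan_cartan p r)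
  simp only [weightGen, Finset.smul_sum, smul_smul, Finset.sum_mul_sum]
  rw [Finset.sum_comm (f := fun r p => ((w * ((d j : ℂ) * _)) • gen (Gen.cartan r)) *
    ((z * ((d i : ℂ) * _)) • gen (Gen.cartan p))), ← Finset.sum_sub_distrib, map_sum]
  refine TwoSidedIdeal.finsetSum_mem _ _ _ fun p _ => ?_
  rw [← Finset.sum_sub_distrib, map_sum]
  refine TwoSidedIdeal.finsetSum_mem _ _ _ fun r _ => ?_
  rw [smul_mul_smul_comm, smul_mul_smul_comm, mul_comm (w * _), ← smul_sub, Algebra.smul_def,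
    map_mul]
  exact TwoSidedIdeal.mul_mem_left _ _ _ (h p r)

/-- The product `∏_p L_p^{z_p}` of commuting factors. -/
def weightExpProd (a : Matrix ι ι ℤ) (d : ι → ℕ) (z : ι → ℂ) : StandardQG a d :=
  Finset.univ.noncommProd (fun p => weightExp a d p (z p))
    (fun p _ r _ _ => commute_weightExp a d p r (z p) (z r))

end Quantum

section Main

variable {𝔤 : Type*} [LieRing 𝔤] [LieAlgebra ℂ 𝔤] [FiniteDimensional ℂ 𝔤]
  [LieAlgebra.IsSimple ℂ 𝔤] {𝔥 : LieSubalgebra ℂ 𝔤} [𝔥.IsCartanSubalgebra]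
  (b : (rootSystem 𝔥).Base) (d : b.support → ℕ) (s : (rootSystem 𝔥).weylGroup)

/-- The standard quantum group `U_h(𝔤)`. -/
abbrev Uh : Type _ := StandardQG (cartan b) d

/-- The realization `U_h^s(𝔤)` corresponding to the Weyl group element `s`. -/
abbrev RealizationUhs : Type _ := DeformedQG (cartan b) d (cayleyCoeff b d s)

/-- The generator `H_i` of `U_h(𝔤)`. -/
def H (i : b.support) : Uh b d := toTopPresented _ (genT (.cartan i))

/-- The generator `X_i^+` of `U_h(𝔤)`. -/
def Xpos (i : b.support) : Uh b d := toTopPresented _ (genT (.pos i))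

/-- The generator `X_i^-` of `U_h(𝔤)`. -/
def Xneg (i : b.support) : Uh b d := toTopPresented _ (genT (.neg i))

/-- The generator `H_i` of `U_h^s(𝔤)`. -/
def Hs (i : b.support) : RealizationUhs b d s := toTopPresented _ (genT (.cartan i))

/-- The generator `e_i` of `U_h^s(𝔤)`. -/
def e (i : b.support) : RealizationUhs b d s := toTopPresented _ (genT (.pos i))

/-- The generator `f_i` of `U_h^s(𝔤)`. -/
def f (i : b.support) : RealizationUhs b d s := toTopPresented _ (genT (.neg i))

/-- The product `∏_p L_p^{z_p}` in `U_h(𝔤)`, where `L_p = e^{h Y_p}`. -/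
abbrev LProd (z : b.support → ℂ) : Uh b d := weightExpProd (cartan b) d z

end Main

end QuantumRealization
end

/-! Conjugation by $L_p$ rescales the generators: since $Y_p$ is built from the inverse Cartan
matrix, $[Y_p,X_j^\pm]=\pm d_p\delta_{pj}X_j^\pm$. Writing $L^z=\prod_pL_p^{z_p}$, this gives
$L^zX_j^\pm=q^{\pm d_jz_j}X_j^\pm L^z$. Multiplying the generators by such exponentials therefore
changes each relation only by powers of $q$. In $e_if_j$ the exponentials produce
$q^{d_in_{ji}-d_jn_{ij}}=q^{-c_{ij}}$, while $f_je_i$ produces no factor (`commutator_twist`). In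
the $r$-th Serre term, collecting the exponentials on the right leaves a scalar whose dependence on
$r$ is $q^{r(d_in_{ji}-d_jn_{ij})}=q^{-rc_{ij}}$, and this cancels the deformation factor
(`serre_sum_twist`, `serre_sum_twist_left`). The argument is run between two realizations with
arbitrary parameters $c$ and $c'$, under $d_jn_{ij}-d_in_{ji}=c_{ij}-c'_{ij}$ (`twistGen_relator`).
The standard quantum group is the case $c'=0$. The condition is antisymmetric under exchanging $c$
with $c'$ and $n$ with $-n$, so the twist by $-n$ goes back; both twists fix every $H_i$ and hence
every exponential, so they are mutually inverse (`twistHom_comp_twistHom`). Two topological points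
support this. First, the quotient by a closed ideal is $h$-adically separated, so a $\mathbb
C[[h]]$-linear homomorphism is determined by its values on generators (`topPresented_algHom_ext`);
this also gives uniqueness. Second, identities between exponentials, which are infinite series, may
be checked coefficient by coefficient modulo the ideal before closure
(`toTopPresented_eq_of_coeffMap`). -/

noncomputable section

namespace QuantumRealization

/-! ### Substitution into the coefficients of a power series -/

section Subst

variable {A B : Type*} [Ring A] [Ring B]

/-- The extension `∑ hⁿ aₙ ↦ ∑ hⁿ φ(aₙ)` to power series of a ring homomorphism `A → B⟦X⟧`, as an
additive map. -/
def substAddHom (φ : A →+* B⟦X⟧) : A⟦X⟧ →+ B⟦X⟧ where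
  toFun x := PowerSeries.mk fun k => ∑ p ∈ Finset.HasAntidiagonal.antidiagonal k,
    PowerSeries.coeff p.2 (φ (PowerSeries.coeff p.1 x))
  map_zero' := by ext; simp
  map_add' x y := by ext; simp [Finset.sum_add_distrib]

theorem coeff_substAddHom (φ : A →+* B⟦X⟧) (k : ℕ) (x : A⟦X⟧) :
    PowerSeries.coeff k (substAddHom φ x) = ∑ p ∈ Finset.HasAntidiagonal.antidiagonal k,
      PowerSeries.coeff p.2 (φ (PowerSeries.coeff p.1 x)) := by
  rw [substAddHom, AddMonoidHom.coe_mk, ZeroHom.coe_mk, PowerSeries.coeff_mk]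

theorem substAddHom_C (φ : A →+* B⟦X⟧) (a : A) : substAddHom φ (PowerSeries.C a) = φ a := by
  ext k
  rw [coeff_substAddHom, Finset.sum_eq_single (0, k)]
  · simp
  · rintro ⟨i, j⟩ hp hne
    have hi : i ≠ 0 := by
      rintro rfl
      simp only [Finset.HasAntidiagonal.mem_antidiagonal, zero_add] at hp
      exact hne (by rw [hp])
    simp [PowerSeries.coeff_C, hi]
  · intro h
    simp at h

theorem substAddHom_mul (φ : A →+* B⟦X⟧) (x y : A⟦X⟧) :
    substAddHom φ (x * y) = substAddHom φ x * substAddHom φ y := by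
  ext k
  simp only [coeff_substAddHom, PowerSeries.coeff_mul, map_sum, map_mul, Finset.sum_mul_sum]
  simp only [Finset.sum_sigma']
  -- Both sides are sums over 2×2 arrays of naturals with total `k`, one grouped by rows and the
  -- other by columns. Transposition, its own inverse, matches them.
  refine Finset.sum_nbij'
    (fun t => ⟨(t.2.1.1 + t.2.2.1, t.2.1.2 + t.2.2.2), ⟨(t.2.1.1, t.2.2.1), (t.2.1.2, t.2.2.2)⟩⟩)
    (fun t => ⟨(t.2.1.1 + t.2.2.1, t.2.1.2 + t.2.2.2), ⟨(t.2.1.1, t.2.2.1), (t.2.1.2, t.2.2.2)⟩⟩)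
    ?_ ?_ ?_ ?_ ?_
  all_goals
    rintro ⟨⟨a, b⟩, ⟨p, q⟩, ⟨r, s⟩⟩ h
    simp only [Finset.mem_sigma, Finset.HasAntidiagonal.mem_antidiagonal] at h ⊢
  · exact ⟨by omega, by simp⟩
  · exact ⟨by omega, by simp⟩
  · obtain ⟨h1, h2, h3⟩ := h
    simp [h2, h3]
  · obtain ⟨h1, h2, h3⟩ := h
    simp [h2, h3]

/-- The extension `∑ hⁿ aₙ ↦ ∑ hⁿ φ(aₙ)` to power series of a ring homomorphism `A → B⟦X⟧`. -/
def substH (φ : A →+* B⟦X⟧) : A⟦X⟧ →+* B⟦X⟧ :=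
  { substAddHom φ with
    map_one' := by
      have := substAddHom_C φ 1
      rw [map_one PowerSeries.C, map_one φ] at this
      exact this
    map_mul' := substAddHom_mul φ }

theorem coeff_substH (φ : A →+* B⟦X⟧) (k : ℕ) (x : A⟦X⟧) :
    PowerSeries.coeff k (substH φ x) = ∑ p ∈ Finset.HasAntidiagonal.antidiagonal k,
      PowerSeries.coeff p.2 (φ (PowerSeries.coeff p.1 x)) := coeff_substAddHom φ k x

theorem substH_C (φ : A →+* B⟦X⟧) (a : A) : substH φ (PowerSeries.C a) = φ a :=
  substAddHom_C φ a

/-- The coefficient of $h^k$ in the image involves only coefficients of index at most `k`. This is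
the $h$-adic continuity that carries closures of ideals to closures. -/
theorem coeff_substH_congr (φ : A →+* B⟦X⟧) {N : ℕ} {x y : A⟦X⟧}
    (h : ∀ k < N, PowerSeries.coeff k x = PowerSeries.coeff k y) :
    ∀ k < N, PowerSeries.coeff k (substH φ x) = PowerSeries.coeff k (substH φ y) := by
  intro k hk
  rw [coeff_substH, coeff_substH]
  refine Finset.sum_congr rfl fun p hp => ?_
  have := Finset.HasAntidiagonal.mem_antidiagonal.1 hp
  rw [h p.1 (by omega)]

/-- When the coefficients go to constants, nothing is carried from one power of $h$ to a higher one,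
so only the pair `(k, 0)` contributes. -/
theorem substH_eq_map (φ : A →+* B⟦X⟧) (ψ : A →+* B) (x : A⟦X⟧)
    (h : ∀ n, φ (PowerSeries.coeff n x) = PowerSeries.C (ψ (PowerSeries.coeff n x))) :
    substH φ x = PowerSeries.map ψ x := by
  ext k
  rw [coeff_substH, Finset.sum_eq_single (k, 0)]
  · simp [h]
  · rintro ⟨i, j⟩ hp hne
    have hj : j ≠ 0 := by
      rintro rfl
      simp only [Finset.HasAntidiagonal.mem_antidiagonal, add_zero] at hp
      exact hne (by rw [hp])
    simp [h, PowerSeries.coeff_C, hj]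
  · intro h
    simp at h

theorem substH_eq_self (φ : A →+* A⟦X⟧) (x : A⟦X⟧)
    (h : ∀ n, φ (PowerSeries.coeff n x) = PowerSeries.C (PowerSeries.coeff n x)) :
    substH φ x = x := by
  rw [substH_eq_map φ (RingHom.id A) x h]
  ext
  simp

end Subst

/-! ### Homomorphisms between topologically presented algebras -/

section Lift

variable {ι κ : Type*}

theorem mem_hClosure {I : TwoSidedIdeal (FreeTop ι)} {x : FreeTop ι} :
    x ∈ hClosure I ↔ ∀ N : ℕ, ∃ y ∈ I, ∀ k < N, PowerSeries.coeff k x = PowerSeries.coeff k y :=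
  TwoSidedIdeal.mem_mk' _ _ _ _ _ _ _

theorem le_hClosure (I : TwoSidedIdeal (FreeTop ι)) {x : FreeTop ι} (hx : x ∈ I) :
    x ∈ hClosure I := mem_hClosure.2 fun _ => ⟨x, hx, fun _ _ => rfl⟩

/-- The closure is closed: an approximation of an approximation to the same order is an
approximation. -/
theorem mem_hClosure_of_forall_exists {I : TwoSidedIdeal (FreeTop ι)} {x : FreeTop ι}
    (h : ∀ N : ℕ, ∃ y ∈ hClosure I, ∀ k < N, PowerSeries.coeff k x = PowerSeries.coeff k y) :
    x ∈ hClosure I := by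
  refine mem_hClosure.2 fun N => ?_
  obtain ⟨y, hy, hxy⟩ := h N
  obtain ⟨z, hz, hyz⟩ := mem_hClosure.1 hy N
  exact ⟨z, hz, fun k hk => (hxy k hk).trans (hyz k hk)⟩

theorem toTopPresented_eq_zero_iff (R : Set (FreeTop ι)) (x : FreeTop ι) :
    toTopPresented R x = 0 ↔ x ∈ hClosure (TwoSidedIdeal.span R) := by
  rw [← map_zero (toTopPresented R), toTopPresented_eq_iff, sub_zero]

theorem toTopPresented_relator {R : Set (FreeTop ι)} {x : FreeTop ι} (hx : x ∈ R) :
    toTopPresented R x = 0 :=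
  (toTopPresented_eq_zero_iff R x).2 (le_hClosure _ (TwoSidedIdeal.subset_span hx))

theorem toTopPresented_smul (R : Set (FreeTop ι)) (f : ℂ⟦X⟧) (x : FreeTop ι) :
    toTopPresented R (f • x) = f • toTopPresented R x := rfl

theorem toTopPresented_surjective (R : Set (FreeTop ι)) :
    Function.Surjective (toTopPresented R) := RingCon.mk'_surjective _

theorem coeff_X_pow_smul_of_lt (N : ℕ) (x : FreeTop ι) (k : ℕ) (hk : k < N) :
    PowerSeries.coeff k ((PowerSeries.X ^ N : ℂ⟦X⟧) • x) = 0 := by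
  rw [smul_freeTop_def, map_pow, PowerSeries.map_X, PowerSeries.coeff_X_pow_mul', if_neg (by omega)]

/-- Topologically presented algebras are `h`-adically separated. -/
theorem eq_zero_of_forall_X_pow_smul (R : Set (FreeTop ι)) (z : TopPresented R)
    (h : ∀ N : ℕ, ∃ w : TopPresented R, z = (PowerSeries.X ^ N : ℂ⟦X⟧) • w) : z = 0 := by
  obtain ⟨x, rfl⟩ := toTopPresented_surjective R z
  rw [toTopPresented_eq_zero_iff]
  refine mem_hClosure_of_forall_exists fun N => ?_
  obtain ⟨w, hw⟩ := h N
  obtain ⟨y, rfl⟩ := toTopPresented_surjective R w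
  rw [← toTopPresented_smul, toTopPresented_eq_iff] at hw
  refine ⟨_, hw, fun k hk => ?_⟩
  rw [map_sub, coeff_X_pow_smul_of_lt N y k hk, sub_zero]

/-- Truncation at order `N`: it reduces questions about series to constants in the free algebra, up
to a multiple of $h^N$. -/
theorem exists_eq_sum_add_X_pow_smul (x : FreeTop ι) (N : ℕ) : ∃ y : FreeTop ι,
    x = ∑ n ∈ Finset.range N,
      (PowerSeries.X ^ n : ℂ⟦X⟧) • (PowerSeries.C (PowerSeries.coeff n x) : FreeTop ι) +
      (PowerSeries.X ^ N : ℂ⟦X⟧) • y := by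
  refine ⟨PowerSeries.mk fun n => PowerSeries.coeff (n + N) x, ?_⟩
  ext k
  simp only [map_add, map_sum, smul_freeTop_def, map_pow, PowerSeries.map_X,
    PowerSeries.coeff_X_pow_mul', PowerSeries.coeff_C, PowerSeries.coeff_mk]
  by_cases hk : N ≤ k
  · rw [Finset.sum_eq_zero, if_pos hk, zero_add, Nat.sub_add_cancel hk]
    intro n hn
    have := Finset.mem_range.1 hn
    rw [if_pos (by omega), if_neg (by omega)]
  · rw [if_neg hk, add_zero, Finset.sum_eq_single k]
    · simp
    · intro n _ hne
      split_ifs <;> first | rfl | omega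
    · intro h
      exact absurd (Finset.mem_range.2 (by omega)) h

theorem C_algebraMap_eq_smul (c : ℂ) :
    (PowerSeries.C (algebraMap ℂ (FreeAlgebra ℂ (Gen ι)) c) : FreeTop ι) =
      (PowerSeries.C c : ℂ⟦X⟧) • (1 : FreeTop ι) := by
  rw [smul_freeTop_def, PowerSeries.map_C, mul_one]

/-- Homomorphisms of `ℂ⟦X⟧`-algebras that agree on the generators are equal: continuity in the
`h`-adic topology is automatic. -/
theorem topPresented_algHom_ext {R : Set (FreeTop ι)} {R' : Set (FreeTop κ)}
    {φ ψ : TopPresented R →ₐ[ℂ⟦X⟧] TopPresented R'}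
    (h : ∀ g, φ (toTopPresented R (genT g)) = ψ (toTopPresented R (genT g))) : φ = ψ := by
  have hC : ∀ a : FreeAlgebra ℂ (Gen ι), φ (toTopPresented R (PowerSeries.C a)) =
      ψ (toTopPresented R (PowerSeries.C a)) := by
    intro a
    induction a using FreeAlgebra.induction with
    | grade0 c => rw [C_algebraMap_eq_smul, toTopPresented_smul, map_smul, map_smul, map_one,
        map_one, map_one]
    | grade1 g => exact h g
    | mul a b ha hb => simp only [map_mul, ha, hb]
    | add a b ha hb => simp only [map_add, ha, hb]
  refine AlgHom.ext fun z => ?_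
  obtain ⟨x, rfl⟩ := toTopPresented_surjective R z
  rw [← sub_eq_zero]
  -- The two maps agree on the truncation at order `N`, so by linearity their difference comes from
  -- the remainder and is divisible by $h^N$, for every `N`.
  refine eq_zero_of_forall_X_pow_smul R' _ fun N => ?_
  obtain ⟨y, hy⟩ := exists_eq_sum_add_X_pow_smul x N
  refine ⟨φ (toTopPresented R y) - ψ (toTopPresented R y), ?_⟩
  rw [hy]
  simp only [map_add, map_sum, toTopPresented_smul, map_smul, hC, smul_sub]
  abel

/-- The homomorphism of completed free algebras with prescribed values on the generators. -/
def freeTopLift (v : Gen ι → FreeTop κ) : FreeTop ι →+* FreeTop κ :=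
  substH (FreeAlgebra.lift ℂ v).toRingHom

theorem freeTopLift_genT (v : Gen ι → FreeTop κ) (g : Gen ι) :
    freeTopLift v (genT g) = v g := by
  rw [freeTopLift, genT, substH_C]
  exact FreeAlgebra.lift_ι_apply v g

theorem freeTopLift_smul (v : Gen ι → FreeTop κ) (f : ℂ⟦X⟧) (x : FreeTop ι) :
    freeTopLift v (f • x) = f • freeTopLift v x := by
  rw [smul_freeTop_def, map_mul, smul_freeTop_def]
  congr 1
  ext k
  rw [freeTopLift, coeff_substH, Finset.sum_eq_single (k, 0)]
  · simp [PowerSeries.algebraMap_apply]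
  · rintro ⟨i, j⟩ hp hne
    have hj : j ≠ 0 := by
      rintro rfl
      simp only [Finset.HasAntidiagonal.mem_antidiagonal, add_zero] at hp
      exact hne (by rw [hp])
    simp [PowerSeries.algebraMap_apply, PowerSeries.coeff_C, hj]
  · intro h
    simp at h

/-- The universal property of a topologically presented algebra. -/
def topLift (R : Set (FreeTop ι)) (R' : Set (FreeTop κ)) (v : Gen ι → FreeTop κ)
    (hv : ∀ x ∈ R, toTopPresented R' (freeTopLift v x) = 0) :
    TopPresented R →ₐ[ℂ⟦X⟧] TopPresented R' :=
  { (hClosure (TwoSidedIdeal.span R)).ringCon.lift ((toTopPresented R').comp (freeTopLift v)) (by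
      have hspan : ∀ x ∈ TwoSidedIdeal.span R, toTopPresented R' (freeTopLift v x) = 0 := by
        intro x hx
        have hle : TwoSidedIdeal.span R ≤
            TwoSidedIdeal.ker ((toTopPresented R').comp (freeTopLift v)) :=
          TwoSidedIdeal.span_le.2 fun y hy => (TwoSidedIdeal.mem_ker _).2 (hv y hy)
        exact (TwoSidedIdeal.mem_ker ((toTopPresented R').comp (freeTopLift v))).1 (hle hx)
      intro x y hxy
      rw [TwoSidedIdeal.rel_iff] at hxy
      rw [RingCon.ker_apply, ← sub_eq_zero, ← map_sub, RingHom.comp_apply,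
        toTopPresented_eq_zero_iff]
      -- An element of the closure agrees modulo $h^N$ with some `u` in the ideal itself.
      -- Substitution preserves this agreement and sends `u` into the closed ideal of the target.
      refine mem_hClosure_of_forall_exists fun N => ?_
      obtain ⟨u, hu, hu'⟩ := mem_hClosure.1 hxy N
      exact ⟨freeTopLift v u, (toTopPresented_eq_zero_iff _ _).1 (hspan u hu),
        coeff_substH_congr _ hu'⟩) with
    commutes' := fun f => by
      change toTopPresented R' (freeTopLift v (algebraMap ℂ⟦X⟧ (FreeTop ι) f)) = _
      rw [Algebra.algebraMap_eq_smul_one, freeTopLift_smul, map_one, toTopPresented_smul, map_one,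
        Algebra.algebraMap_eq_smul_one] }

theorem topLift_toTopPresented (R : Set (FreeTop ι)) (R' : Set (FreeTop κ))
    (v : Gen ι → FreeTop κ) (hv : ∀ x ∈ R, toTopPresented R' (freeTopLift v x) = 0)
    (x : FreeTop ι) :
    topLift R R' v hv (toTopPresented R x) = toTopPresented R' (freeTopLift v x) := rfl

end Lift

/-! ### Exponentials of elements of a complex algebra -/

section Exponential

variable {A B : Type*} [Ring A] [Algebra ℂ A] [Ring B] [Algebra ℂ B]

theorem map_expH (φ : A →ₐ[ℂ] B) (a : A) :
    PowerSeries.map φ.toRingHom (expH a) = expH (φ a) := by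
  ext n
  rw [PowerSeries.coeff_map, coeff_expH, coeff_expH]
  simp

/-- Multiplication by `x` intertwines `y + z` and `y`, hence all their powers, hence the
exponentials coefficientwise. -/
theorem expH_mul_C (y x : A) (z : ℂ) (h : y * x = x * (y + algebraMap ℂ A z)) :
    expH y * PowerSeries.C x = PowerSeries.C x * expH (y + algebraMap ℂ A z) := by
  have hs : SemiconjBy x (y + algebraMap ℂ A z) y := h.symm
  ext n
  rw [PowerSeries.coeff_mul_C, PowerSeries.coeff_C_mul, coeff_expH, coeff_expH, smul_mul_assoc,
    mul_smul_comm, (hs.pow_right n).eq]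

theorem expH_algebraMap (z : ℂ) :
    expH (algebraMap ℂ A z) = PowerSeries.map (algebraMap ℂ A) (qPow z) := by
  ext n
  rw [PowerSeries.coeff_map, qPow, coeff_expH, coeff_expH, smul_eq_mul, map_mul, map_pow,
    Algebra.smul_def]

theorem expH_add_algebraMap (y : A) (z : ℂ) :
    expH (y + algebraMap ℂ A z) = expH y * PowerSeries.map (algebraMap ℂ A) (qPow z) := by
  rw [← expH_algebraMap, expH_mul_of_commute _ _ (Algebra.commutes z y).symm]

theorem qPow_add (z w : ℂ) : qPow (z + w) = qPow z * qPow w :=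
  (expH_mul_of_commute z w (Commute.all z w)).symm

theorem qPow_zero : qPow 0 = 1 := expH_zero

theorem qPow_nat_mul (m : ℕ) (z : ℂ) : qPow (m * z) = qPow z ^ m := by
  induction m with
  | zero => simp [qPow_zero]
  | succ m ih => rw [pow_succ, ← ih, ← qPow_add]; congr 1; push_cast; ring

end Exponential

/-! ### Passing to the quotient of the coefficients -/

section Coefficients

variable {ι : Type*} (R : Set (FreeTop ι))

/-- The quotient of the completed free algebra by the ideal generated by `R`, before closure. -/
abbrev PreQuotient : Type _ := (TwoSidedIdeal.span R).ringCon.Quotient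

/-- The image of the free algebra in the quotient of its completion. -/
def coeffHom : FreeAlgebra ℂ (Gen ι) →ₐ[ℂ] PreQuotient R :=
  { (TwoSidedIdeal.span R).ringCon.mk'.comp PowerSeries.C with
    commutes' := fun z => by
      change (TwoSidedIdeal.span R).ringCon.mk' (PowerSeries.C (algebraMap ℂ _ z)) =
        (TwoSidedIdeal.span R).ringCon.mk' (algebraMap ℂ (FreeTop ι) z)
      rw [PowerSeries.algebraMap_apply] }

theorem coeffHom_eq_zero_iff (a : FreeAlgebra ℂ (Gen ι)) :
    coeffHom R a = 0 ↔ (PowerSeries.C a : FreeTop ι) ∈ TwoSidedIdeal.span R := by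
  have h : coeffHom R a = 0 ↔ (TwoSidedIdeal.span R).ringCon (PowerSeries.C a) 0 := by
    rw [← (TwoSidedIdeal.span R).ringCon.eq]
    rfl
  rw [h, TwoSidedIdeal.rel_iff, sub_zero]

/-- The coefficientwise quotient map. -/
def coeffMap : FreeTop ι →+* (PreQuotient R)⟦X⟧ := PowerSeries.map (coeffHom R).toRingHom

theorem coeffMap_C (a : FreeAlgebra ℂ (Gen ι)) :
    coeffMap R (PowerSeries.C a) = PowerSeries.C (coeffHom R a) := PowerSeries.map_C _ _

theorem coeff_coeffMap (x : FreeTop ι) (n : ℕ) :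
    PowerSeries.coeff n (coeffMap R x) = coeffHom R (PowerSeries.coeff n x) :=
  PowerSeries.coeff_map _ _ _

theorem coeffMap_expH (a : FreeAlgebra ℂ (Gen ι)) :
    coeffMap R (expH a) = expH (coeffHom R a) := map_expH _ _

theorem coeffMap_smul (f : ℂ⟦X⟧) (x : FreeTop ι) :
    coeffMap R (f • x) = PowerSeries.map (algebraMap ℂ (PreQuotient R)) f * coeffMap R x := by
  rw [smul_freeTop_def, map_mul]
  congr 1
  ext n
  rw [coeff_coeffMap, PowerSeries.coeff_map, PowerSeries.coeff_map]
  exact (coeffHom R).commutes _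

/-- If every coefficient of `x` lies in the unclosed ideal, so does every truncation of `x`, and
these converge to `x`. The outer variable of the series over `PreQuotient R` is kept separate from
the $h$ already present in `PreQuotient R`, so the criterion is only sufficient. It allows
exponentials to be manipulated as formal series over an ordinary algebra. -/
theorem toTopPresented_eq_zero_of_coeffMap (x : FreeTop ι) (h : coeffMap R x = 0) :
    toTopPresented R x = 0 := by
  rw [toTopPresented_eq_zero_iff, mem_hClosure]
  intro N
  obtain ⟨y, hy⟩ := exists_eq_sum_add_X_pow_smul x N
  refine ⟨_, TwoSidedIdeal.finsetSum_mem _ (Finset.range N) (fun n =>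
    (PowerSeries.X ^ n : ℂ⟦X⟧) • (PowerSeries.C (PowerSeries.coeff n x) : FreeTop ι))
    fun n _ => ?_, fun k hk => ?_⟩
  · rw [smul_freeTop_def]
    refine TwoSidedIdeal.mul_mem_left _ _ _ ((coeffHom_eq_zero_iff R _).1 ?_)
    rw [← coeff_coeffMap, h, map_zero]
  · conv_lhs => rw [hy, map_add, coeff_X_pow_smul_of_lt N y k hk, add_zero]

theorem toTopPresented_eq_of_coeffMap {x y : FreeTop ι} (h : coeffMap R x = coeffMap R y) :
    toTopPresented R x = toTopPresented R y := by
  rw [← sub_eq_zero, ← map_sub]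
  exact toTopPresented_eq_zero_of_coeffMap R _ (by rw [map_sub, h, sub_self])

theorem toTopPresented_expH_mul {a b : FreeAlgebra ℂ (Gen ι)}
    (h : Commute (coeffHom R a) (coeffHom R b)) :
    toTopPresented R (expH a) * toTopPresented R (expH b) = toTopPresented R (expH (a + b)) := by
  rw [← map_mul]
  refine toTopPresented_eq_of_coeffMap R ?_
  rw [map_mul, coeffMap_expH, coeffMap_expH, coeffMap_expH, expH_mul_of_commute _ _ h, map_add]

theorem toTopPresented_expH_mul_C {y x : FreeAlgebra ℂ (Gen ι)} {z : ℂ}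
    (h : coeffHom R y * coeffHom R x = coeffHom R x * (coeffHom R y + algebraMap ℂ _ z)) :
    toTopPresented R (expH y) * toTopPresented R (PowerSeries.C x) =
      qPow z • (toTopPresented R (PowerSeries.C x) * toTopPresented R (expH y)) := by
  rw [← map_mul, ← map_mul, ← toTopPresented_smul]
  refine toTopPresented_eq_of_coeffMap R ?_
  rw [coeffMap_smul, map_mul, map_mul, coeffMap_expH, coeffMap_C, expH_mul_C _ _ z h,
    expH_add_algebraMap, ← mul_assoc]
  -- What remains is that a series with scalar coefficients is central.
  ext n
  rw [PowerSeries.coeff_mul, PowerSeries.coeff_mul, ← Finset.Nat.sum_antidiagonal_swap]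
  refine Finset.sum_congr rfl fun p _ => ?_
  rw [Prod.fst_swap, Prod.snd_swap, PowerSeries.coeff_map]
  exact (Algebra.commutes _ _).symm

theorem commute_toTopPresented {x y : FreeTop ι} (h : ∀ m n,
    Commute (coeffHom R (PowerSeries.coeff m x)) (coeffHom R (PowerSeries.coeff n y))) :
    Commute (toTopPresented R x) (toTopPresented R y) := by
  rw [commute_iff_eq, ← map_mul, ← map_mul]
  refine toTopPresented_eq_of_coeffMap R ?_
  rw [map_mul, map_mul]
  ext n
  rw [PowerSeries.coeff_mul, PowerSeries.coeff_mul, ← Finset.Nat.sum_antidiagonal_swap]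
  refine Finset.sum_congr rfl fun p _ => ?_
  rw [Prod.fst_swap, Prod.snd_swap, coeff_coeffMap, coeff_coeffMap]
  exact (h _ _).eq

end Coefficients

/-! ### Exponentials in the realizations -/

section Weights

variable {ι : Type*} {a : Matrix ι ι ℤ} {d : ι → ℕ} {c : ι → ι → ℂ}

/-- The linear combination `∑ z_p Y_p` of weight-type generators. -/
def weightComb [Fintype ι] (a : Matrix ι ι ℤ) (d : ι → ℕ) (z : ι → ℂ) : FreeAlgebra ℂ (Gen ι) :=
  ∑ p, z p • weightGen a d p

theorem weightComb_add [Fintype ι] (z w : ι → ℂ) :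
    weightComb a d (z + w) = weightComb a d z + weightComb a d w := by
  simp [weightComb, add_smul, Finset.sum_add_distrib]

theorem weightComb_zero [Fintype ι] : weightComb a d 0 = 0 := by
  simp [weightComb]

theorem map_weightComb [Fintype ι] {B : Type*} [Ring B] [Algebra ℂ B]
    (φ : FreeAlgebra ℂ (Gen ι) →ₐ[ℂ] B) (z : ι → ℂ) :
    φ (weightComb a d z) = ∑ p, z p • φ (weightGen a d p) := by
  simp [weightComb]

/-- The relators of the realization with parameters `c`, as a set. -/
abbrev deformedRelators (a : Matrix ι ι ℤ) (d : ι → ℕ) (c : ι → ι → ℂ) : Set (FreeTop ι) :=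
  {x | DeformedRelator a d c x}

theorem coeffHom_cartan_commute (i j : ι) :
    Commute (coeffHom (deformedRelators a d c) (gen (.cartan i)))
      (coeffHom (deformedRelators a d c) (gen (.cartan j))) := by
  rw [commute_iff_eq, ← sub_eq_zero, ← map_mul, ← map_mul, ← map_sub, coeffHom_eq_zero_iff,
    map_sub, map_mul, map_mul]
  exact TwoSidedIdeal.subset_span (DeformedRelator.cartan_cartan i j)

theorem coeffHom_cartan_pos (i j : ι) :
    coeffHom (deformedRelators a d c) (gen (.cartan i)) *
        coeffHom (deformedRelators a d c) (gen (.pos j)) =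
      coeffHom (deformedRelators a d c) (gen (.pos j)) *
        coeffHom (deformedRelators a d c) (gen (.cartan i)) +
      (a i j : ℂ) • coeffHom (deformedRelators a d c) (gen (.pos j)) := by
  rw [← sub_eq_zero, ← sub_sub, Int.cast_smul_eq_zsmul, ← map_mul, ← map_mul, ← map_sub, ← map_zsmul,
    ← map_sub, coeffHom_eq_zero_iff, map_sub, map_sub, map_mul, map_mul, map_zsmul]
  exact TwoSidedIdeal.subset_span (DeformedRelator.cartan_pos i j)

theorem coeffHom_cartan_neg (i j : ι) :
    coeffHom (deformedRelators a d c) (gen (.cartan i)) *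
        coeffHom (deformedRelators a d c) (gen (.neg j)) =
      coeffHom (deformedRelators a d c) (gen (.neg j)) *
        coeffHom (deformedRelators a d c) (gen (.cartan i)) +
      (-(a i j : ℂ)) • coeffHom (deformedRelators a d c) (gen (.neg j)) := by
  rw [← sub_eq_zero, ← sub_sub, neg_smul, sub_neg_eq_add, Int.cast_smul_eq_zsmul, ← map_mul,
    ← map_mul, ← map_sub, ← map_zsmul,
    ← map_add, coeffHom_eq_zero_iff, map_add, map_sub, map_mul, map_mul, map_zsmul]
  exact TwoSidedIdeal.subset_span (DeformedRelator.cartan_neg i j)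

variable [Fintype ι]

theorem coeffHom_weightComb_commute {x : FreeAlgebra ℂ (Gen ι)}
    (hx : ∀ j, Commute (coeffHom (deformedRelators a d c) (gen (.cartan j)))
      (coeffHom (deformedRelators a d c) x)) (z : ι → ℂ) :
    Commute (coeffHom (deformedRelators a d c) (weightComb a d z))
      (coeffHom (deformedRelators a d c) x) := by
  rw [map_weightComb]
  refine Commute.sum_left _ _ _ fun p _ => Commute.smul_left ?_ _
  simp only [weightGen, map_sum, map_smul]
  exact Commute.sum_left _ _ _ fun j _ => Commute.smul_left (hx j) _

theorem coeffHom_weightComb_cartan (z : ι → ℂ) (i : ι) :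
    Commute (coeffHom (deformedRelators a d c) (weightComb a d z))
      (coeffHom (deformedRelators a d c) (gen (.cartan i))) :=
  coeffHom_weightComb_commute (fun _ => coeffHom_cartan_commute _ _) z

theorem coeffHom_weightComb_weightComb (z w : ι → ℂ) :
    Commute (coeffHom (deformedRelators a d c) (weightComb a d z))
      (coeffHom (deformedRelators a d c) (weightComb a d w)) :=
  coeffHom_weightComb_commute (fun j => (coeffHom_weightComb_cartan w j).symm) z

open Classical in
-- From $[H_i,x]=\varepsilon a_{ij}x$ and $\sum_k(a^{-1})_{pk}a_{kj}=\delta_{pj}$ one gets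
-- $[Y_p,x]=\varepsilon d_p\delta_{pj}x$, so only the coefficient $z_j$ survives. The sign
-- $\varepsilon=\pm1$ serves the positive and negative generators together.
theorem coeffHom_weightComb_mul (ha : (a.map (Int.cast : ℤ → ℂ))⁻¹ * a.map (Int.cast : ℤ → ℂ) = 1)
    {x : FreeAlgebra ℂ (Gen ι)} (j : ι) (ε : ℂ)
    (hx : ∀ i, coeffHom (deformedRelators a d c) (gen (.cartan i)) *
        coeffHom (deformedRelators a d c) x = coeffHom (deformedRelators a d c) x *
        coeffHom (deformedRelators a d c) (gen (.cartan i)) +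
        (ε * (a i j : ℂ)) • coeffHom (deformedRelators a d c) x) (z : ι → ℂ) :
    coeffHom (deformedRelators a d c) (weightComb a d z) * coeffHom (deformedRelators a d c) x =
      coeffHom (deformedRelators a d c) x *
        (coeffHom (deformedRelators a d c) (weightComb a d z) +
          algebraMap ℂ _ (ε * (d j * z j))) := by
  have hw : ∀ p, coeffHom (deformedRelators a d c) (weightGen a d p) *
      coeffHom (deformedRelators a d c) x = coeffHom (deformedRelators a d c) x *
        coeffHom (deformedRelators a d c) (weightGen a d p) +
        (ε * d p * if p = j then 1 else 0) • coeffHom (deformedRelators a d c) x := by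
    intro p
    have hpj := congrFun (congrFun ha p) j
    rw [Matrix.mul_apply, Matrix.one_apply] at hpj
    simp only [weightGen, map_sum, map_smul, Finset.sum_mul, Finset.mul_sum, smul_mul_assoc, hx,
      smul_add, Finset.sum_add_distrib, mul_smul_comm, smul_smul, ← Finset.sum_smul]
    rw [← hpj, Finset.mul_sum]
    congr 2
    refine Finset.sum_congr rfl fun k _ => ?_
    rw [Matrix.map_apply]
    ring
  rw [map_weightComb, mul_add, ← Algebra.commutes, ← Algebra.smul_def, Finset.sum_mul,
    Finset.mul_sum]
  simp only [smul_mul_assoc, hw, smul_add, Finset.sum_add_distrib, mul_smul_comm, smul_smul,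
    ← Finset.sum_smul]
  congr 2
  simp only [mul_ite, mul_one, mul_zero, Finset.sum_ite_eq', Finset.mem_univ, if_true]
  ring

/-- The exponential `∏ L_p ^ z_p` in the realization with parameters `c`. -/
def weightExpComb (a : Matrix ι ι ℤ) (d : ι → ℕ) (c : ι → ι → ℂ) (z : ι → ℂ) : DeformedQG a d c :=
  toTopPresented _ (expH (weightComb a d z))

theorem weightExpComb_mul (z w : ι → ℂ) :
    weightExpComb a d c z * weightExpComb a d c w = weightExpComb a d c (z + w) := by
  rw [weightExpComb, weightExpComb, weightExpComb, weightComb_add]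
  exact toTopPresented_expH_mul _ (coeffHom_weightComb_weightComb z w)

theorem weightExpComb_zero : weightExpComb a d c 0 = 1 := by
  rw [weightExpComb, weightComb_zero, expH_zero, map_one]

theorem weightExpComb_commute (z w : ι → ℂ) :
    Commute (weightExpComb a d c z) (weightExpComb a d c w) := by
  rw [commute_iff_eq, weightExpComb_mul, weightExpComb_mul, add_comm]

theorem weightExpComb_cartan (z : ι → ℂ) (i : ι) : Commute (weightExpComb a d c z)
    (toTopPresented (deformedRelators a d c) (genT (.cartan i))) := by
  refine commute_toTopPresented _ fun m n => ?_
  rw [coeff_expH, genT, PowerSeries.coeff_C, map_smul, map_pow]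
  split_ifs
  · exact ((coeffHom_weightComb_cartan z i).pow_left m).smul_left _
  · rw [map_zero]
    exact Commute.zero_right _

/-- Every coefficient is a polynomial in $H_i$, and the weight combinations commute with $H_i$. -/
theorem weightExpComb_cartanQuotient (z : ι → ℂ) (i : ι) : Commute (weightExpComb a d c z)
    (toTopPresented (deformedRelators a d c) (cartanQuotient d i)) := by
  rw [cartanQuotient, toTopPresented_smul]
  refine Commute.smul_right ?_ _
  refine commute_toTopPresented _ fun m n => ?_
  rw [divH, PowerSeries.coeff_mk, map_sub, coeff_expH, coeff_expH, coeff_expH]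
  simp only [map_sub, map_smul, map_pow, map_neg]
  have h := coeffHom_weightComb_cartan (a := a) (d := d) (c := c) z i
  exact ((((h.smul_right _).pow_right _).smul_right _).sub_right
    (((h.smul_right _).neg_right.pow_right _).smul_right _)).pow_left m |>.smul_left _

open Classical in
theorem weightExpComb_pos (ha : (a.map (Int.cast : ℤ → ℂ))⁻¹ * a.map (Int.cast : ℤ → ℂ) = 1)
    (z : ι → ℂ) (j : ι) :
    weightExpComb a d c z * toTopPresented (deformedRelators a d c) (genT (.pos j)) =
      qPow (d j * z j) • (toTopPresented (deformedRelators a d c) (genT (.pos j)) *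
        weightExpComb a d c z) := by
  refine toTopPresented_expH_mul_C _ ?_
  have := coeffHom_weightComb_mul (c := c) (d := d) ha j 1 (x := gen (.pos j))
    (fun i => by rw [one_mul]; exact coeffHom_cartan_pos i j) z
  rwa [one_mul] at this

open Classical in
theorem weightExpComb_neg (ha : (a.map (Int.cast : ℤ → ℂ))⁻¹ * a.map (Int.cast : ℤ → ℂ) = 1)
    (z : ι → ℂ) (j : ι) :
    weightExpComb a d c z * toTopPresented (deformedRelators a d c) (genT (.neg j)) =
      qPow (-(d j * z j)) • (toTopPresented (deformedRelators a d c) (genT (.neg j)) *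
        weightExpComb a d c z) := by
  refine toTopPresented_expH_mul_C _ ?_
  have := coeffHom_weightComb_mul (c := c) (d := d) ha j (-1) (x := gen (.neg j))
    (fun i => by rw [neg_one_mul]; exact coeffHom_cartan_neg i j) z
  rwa [neg_one_mul] at this

end Weights

/-! ### Twisting relations by quasi-commuting elements -/

section Twist

variable {S G : Type*} [CommRing S] [Ring G] [Algebra S G]

theorem pow_mul_of_mul_eq_smul {T E : G} {α : S} (h : T * E = α • (E * T)) (k : ℕ) :
    T ^ k * E = α ^ k • (E * T ^ k) := by
  induction k with
  | zero => simp
  | succ k ih =>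
    rw [pow_succ, mul_assoc, h, mul_smul_comm, ← mul_assoc, ih, smul_mul_assoc, smul_smul,
      mul_assoc, ← pow_succ, ← pow_succ']

theorem mul_pow_of_mul_eq_smul {T E : G} {α : S} (h : T * E = α • (E * T)) (k : ℕ) :
    T * E ^ k = α ^ k • (E ^ k * T) := by
  induction k with
  | zero => simp
  | succ k ih =>
    rw [pow_succ, ← mul_assoc, ih, smul_mul_assoc, mul_assoc, h, mul_smul_comm, smul_smul,
      ← pow_succ, ← mul_assoc]

theorem pow_mul_pow_of_mul_eq_smul {T E : G} {α : S} (h : T * E = α • (E * T)) (k l : ℕ) :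
    T ^ k * E ^ l = α ^ (k * l) • (E ^ l * T ^ k) := by
  rw [mul_pow_of_mul_eq_smul (pow_mul_of_mul_eq_smul h k) l, ← pow_mul]

/-- Each `T` must pass every `E` to its right, which is one exchange for each pair among the `k`
factors. -/
theorem mul_pow_eq_smul {T E : G} {α : S} (h : T * E = α • (E * T)) (k : ℕ) :
    (E * T) ^ k = α ^ k.choose 2 • (E ^ k * T ^ k) := by
  induction k with
  | zero => simp
  | succ k ih =>
    rw [pow_succ, ih, smul_mul_assoc, mul_assoc, ← mul_assoc (T ^ k), pow_mul_of_mul_eq_smul h,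
      smul_mul_assoc, mul_smul_comm, smul_smul, ← pow_add, mul_assoc, ← mul_assoc (E ^ k),
      ← pow_succ, ← pow_succ, Nat.choose_succ_succ' k 1, Nat.choose_one_right, add_comm k (k.choose _)]

theorem serre_term_twist {E E' T T' : G} {α β γ : S} (hE : T * E = α • (E * T))
    (hE' : T * E' = β • (E' * T)) (hT' : T' * E = γ • (E * T')) (hT : Commute T T') (u r : ℕ) :
    (E * T) ^ u * (E' * T') * (E * T) ^ r =
      (α ^ (u + r).choose 2 * β ^ u * γ ^ r) • (E ^ u * E' * E ^ r * (T' * T ^ (u + r))) := by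
  have h1 : T ^ u * (E' * T') = β ^ u • (E' * T' * T ^ u) := by
    rw [← mul_assoc, pow_mul_of_mul_eq_smul hE', smul_mul_assoc, mul_assoc, mul_assoc,
      (hT.pow_left u).eq]
  -- The exponents of `α` come from reordering each of the two powers and from moving `T ^ u` past
  -- `E ^ r`. Their sum depends only on `u + r`, so `α` contributes the same scalar to all terms of
  -- a Serre sum.
  have hc : (u + r).choose 2 = u.choose 2 + r.choose 2 + u * r := by
    induction r with
    | zero => simp
    | succ r ih =>
      rw [← add_assoc, Nat.choose_succ_succ, ih, Nat.choose_succ_succ r, Nat.choose_one_right,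
        Nat.choose_one_right]
      ring
  calc (E * T) ^ u * (E' * T') * (E * T) ^ r
      = (α ^ u.choose 2 * α ^ r.choose 2) •
          (E ^ u * (T ^ u * (E' * T')) * (E ^ r * T ^ r)) := by
        rw [mul_pow_eq_smul hE, mul_pow_eq_smul hE, smul_mul_assoc, smul_mul_assoc,
          mul_smul_comm, smul_smul]
        simp only [mul_assoc]
    _ = (α ^ u.choose 2 * α ^ r.choose 2 * β ^ u) •
          (E ^ u * E' * (T' * (T ^ u * E ^ r)) * T ^ r) := by
        rw [h1, mul_smul_comm, smul_mul_assoc, smul_smul]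
        simp only [mul_assoc]
    _ = (α ^ u.choose 2 * α ^ r.choose 2 * β ^ u * α ^ (u * r)) •
          (E ^ u * E' * (T' * E ^ r) * (T ^ u * T ^ r)) := by
        rw [pow_mul_pow_of_mul_eq_smul hE, mul_smul_comm, mul_smul_comm, smul_mul_assoc, smul_smul]
        simp only [mul_assoc]
    _ = (α ^ u.choose 2 * α ^ r.choose 2 * β ^ u * α ^ (u * r) * γ ^ r) •
          (E ^ u * E' * E ^ r * (T' * T ^ (u + r))) := by
        rw [mul_pow_of_mul_eq_smul hT', mul_smul_comm, smul_mul_assoc, smul_smul, pow_add]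
        simp only [mul_assoc]
    _ = _ := by
        congr 1
        rw [hc]
        ring

/-- Once the `T` factors stand on the right, the scalar of the `r`-th term is a constant times
$\beta^{m-r}\gamma^r$. The condition `γ * w = β * w'`, stated without inverses, trades $\gamma^rw^r$
for $\beta^rw'^r$, so a common scalar and a common right factor come out of the sum. -/
theorem serre_sum_twist {E E' T T' : G} {α β γ w w' : S} (hE : T * E = α • (E * T))
    (hE' : T * E' = β • (E' * T)) (hT' : T' * E = γ • (E * T')) (hT : Commute T T')
    (hw : γ * w = β * w') (m : ℕ) (b : ℕ → S)
    (h0 : ∑ r ∈ Finset.range (m + 1), (b r * w' ^ r) • (E ^ (m - r) * E' * E ^ r) = 0) :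
    ∑ r ∈ Finset.range (m + 1), (b r * w ^ r) • ((E * T) ^ (m - r) * (E' * T') * (E * T) ^ r) =
      0 := by
  have key : ∀ r ∈ Finset.range (m + 1),
      (b r * w ^ r) • ((E * T) ^ (m - r) * (E' * T') * (E * T) ^ r) =
      (α ^ m.choose 2 * β ^ m) •
        ((b r * w' ^ r) • (E ^ (m - r) * E' * E ^ r) * (T' * T ^ m)) := by
    intro r hr
    obtain ⟨u, rfl⟩ : ∃ u, m = u + r :=
      ⟨m - r, by have := Finset.mem_range.1 hr; omega⟩
    rw [Nat.add_sub_cancel, serre_term_twist hE hE' hT' hT, smul_mul_assoc, smul_smul, smul_smul]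
    congr 1
    have hwr : γ ^ r * w ^ r = β ^ r * w' ^ r := by rw [← mul_pow, hw, mul_pow]
    calc b r * w ^ r * (α ^ (u + r).choose 2 * β ^ u * γ ^ r)
        = b r * α ^ (u + r).choose 2 * β ^ u * (γ ^ r * w ^ r) := by ring
      _ = _ := by rw [hwr]; ring
  rw [Finset.sum_congr rfl key, ← Finset.smul_sum, ← Finset.sum_mul, h0, zero_mul, smul_zero]

/-- Moving each `U` to the right of its own `F` costs `α` for each of the `m` factors and `α'` once.
This total does not depend on `r`, so the right-handed twist applies. -/
theorem serre_sum_twist_left {F F' U U' : G} {α α' β γ w w' : S} (hF : U * F = α • (F * U))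
    (hF' : U * F' = β • (F' * U)) (hU' : U' * F = γ • (F * U')) (hU'F' : U' * F' = α' • (F' * U'))
    (hU : Commute U U') (hw : γ * w = β * w') (m : ℕ) (b : ℕ → S)
    (h0 : ∑ r ∈ Finset.range (m + 1), (b r * w' ^ r) • (F ^ (m - r) * F' * F ^ r) = 0) :
    ∑ r ∈ Finset.range (m + 1), (b r * w ^ r) • ((U * F) ^ (m - r) * (U' * F') * (U * F) ^ r) =
      0 := by
  have key : ∀ r ∈ Finset.range (m + 1),
      (b r * w ^ r) • ((U * F) ^ (m - r) * (U' * F') * (U * F) ^ r) = (α ^ m * α') •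
        ((b r * w ^ r) • ((F * U) ^ (m - r) * (F' * U') * (F * U) ^ r)) := by
    intro r hr
    obtain ⟨u, rfl⟩ : ∃ u, m = u + r :=
      ⟨m - r, by have := Finset.mem_range.1 hr; omega⟩
    rw [Nat.add_sub_cancel, hF, hU'F', smul_pow, smul_pow]
    simp only [smul_mul_assoc, mul_smul_comm, smul_smul]
    congr 1
    ring
  rw [Finset.sum_congr rfl key, ← Finset.smul_sum, serre_sum_twist hF hF' hU' hU hw m b h0,
    smul_zero]

/-- A twist of the relation between `E` and `F`, with `U` inverse to `T'`. -/
theorem commutator_twist {E F T U : G} {β γ v v' : S} (hTF : T * F = β • (F * T))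
    (hEU : E * U = γ • (U * E)) (hTU : Commute T U) (hv : v = γ * β * v') :
    E * T * (U * F) - v • (U * F * (E * T)) =
      (γ * β) • (U * (E * F - v' • (F * E)) * T) := by
  have h1 : E * T * (U * F) = (γ * β) • (U * (E * F) * T) := by
    calc E * T * (U * F) = E * (T * U) * F := by simp only [mul_assoc]
      _ = E * U * (T * F) := by rw [hTU.eq]; simp only [mul_assoc]
      _ = _ := by
        rw [hTF, hEU, smul_mul_assoc, mul_smul_comm, smul_smul]
        simp only [mul_assoc]
  have h2 : U * F * (E * T) = U * (F * E) * T := by simp only [mul_assoc]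
  rw [h1, h2, mul_sub, sub_mul, smul_sub, mul_smul_comm, smul_mul_assoc, smul_smul, hv]

end Twist

/-! ### Twisting homomorphisms between realizations -/

section Realizations

/-- Since $q^0=1$, the standard quantum group is the member $c=0$ of the deformed family. Source and
target are then of the same kind, and the inverse map is again a twist. -/
theorem standardRelators_eq {ι : Type*} (a : Matrix ι ι ℤ) (d : ι → ℕ) :
    {x | StandardRelator a d x} = deformedRelators a d 0 := by
  ext x
  constructor
  · rintro (⟨i, j⟩ | ⟨i, j⟩ | ⟨i, j⟩ | ⟨i, j⟩ | ⟨i, j, hij⟩ | ⟨i, j, hij⟩)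
    · exact .cartan_cartan i j
    · exact .cartan_pos i j
    · exact .cartan_neg i j
    · simpa [qPow_zero] using DeformedRelator.pos_neg (a := a) (d := d) (c := 0) i j
    · simpa [qPow_zero] using DeformedRelator.serre_pos (a := a) (d := d) (c := 0) i j hij
    · simpa [qPow_zero] using DeformedRelator.serre_neg (a := a) (d := d) (c := 0) i j hij
  · rintro (⟨i, j⟩ | ⟨i, j⟩ | ⟨i, j⟩ | ⟨i, j⟩ | ⟨i, j, hij⟩ | ⟨i, j, hij⟩)
    · exact .cartan_cartan i j
    · exact .cartan_pos i j
    · exact .cartan_neg i j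
    · simpa [qPow_zero] using StandardRelator.pos_neg (a := a) (d := d) i j
    · simpa [qPow_zero] using StandardRelator.serre_pos (a := a) (d := d) i j hij
    · simpa [qPow_zero] using StandardRelator.serre_neg (a := a) (d := d) i j hij

variable {ι : Type*} [Fintype ι] {a : Matrix ι ι ℤ} {d : ι → ℕ} {c c' : ι → ι → ℂ}

/-- The values on generators of the twist by `n`. -/
def twistGen (a : Matrix ι ι ℤ) (d : ι → ℕ) (n : ι → ι → ℂ) : Gen ι → FreeTop ι
  | .cartan i => genT (.cartan i)
  | .pos i => genT (.pos i) * expH (weightComb a d (n i))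
  | .neg i => expH (weightComb a d (-n i)) * genT (.neg i)

/-- The inclusion of constants, as a homomorphism of complex algebras. -/
def constHom (A : Type*) [Ring A] [Algebra ℂ A] : A →ₐ[ℂ] A⟦X⟧ :=
  { (PowerSeries.C : A →+* A⟦X⟧) with
    commutes' := fun z => (PowerSeries.algebraMap_apply (R := ℂ) (A := A) (r := z)).symm }

theorem freeTopLift_eq_self {κ : Type*} (v : Gen κ → FreeTop κ) (x : FreeTop κ)
    (h : ∀ n, FreeAlgebra.lift ℂ v (PowerSeries.coeff n x) =
      constHom (FreeAlgebra ℂ (Gen κ)) (PowerSeries.coeff n x)) : freeTopLift v x = x :=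
  substH_eq_self _ _ h

/-- The twist fixes every $H_j$, hence every series whose coefficients are polynomials in them. -/
theorem freeTopLift_twistGen_expH (n : ι → ι → ℂ) (z : ι → ℂ) :
    freeTopLift (twistGen a d n) (expH (weightComb a d z)) = expH (weightComb a d z) := by
  refine freeTopLift_eq_self _ _ fun k => ?_
  rw [coeff_expH, map_smul, map_smul, map_pow, map_pow, map_weightComb, map_weightComb]
  have h : ∀ j, FreeAlgebra.lift ℂ (twistGen a d n) (gen (.cartan j)) =
    constHom (FreeAlgebra ℂ (Gen ι)) (gen (.cartan j)) := fun _ => FreeAlgebra.lift_ι_apply _ _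
  simp only [weightGen, map_sum, map_smul, h]

theorem freeTopLift_twistGen_cartanQuotient (n : ι → ι → ℂ) (i : ι) :
    freeTopLift (twistGen a d n) (cartanQuotient d i) = cartanQuotient d i := by
  rw [cartanQuotient, freeTopLift_smul]
  congr 1
  refine freeTopLift_eq_self _ _ fun k => ?_
  have h : FreeAlgebra.lift ℂ (twistGen a d n) (gen (.cartan i)) =
    constHom (FreeAlgebra ℂ (Gen ι)) (gen (.cartan i)) := FreeAlgebra.lift_ι_apply _ _
  rw [divH, PowerSeries.coeff_mk, map_sub, coeff_expH, coeff_expH]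
  simp only [map_sub, map_smul, map_pow, map_neg, h]

open Classical in
-- Each relator is sent to a multiple of the corresponding relator with parameters `c'`, up to
-- exponential and scalar factors; `hn` is exactly what makes the powers of $q$ match.
theorem twistGen_relator (ha : (a.map (Int.cast : ℤ → ℂ))⁻¹ * a.map (Int.cast : ℤ → ℂ) = 1)
    (n : ι → ι → ℂ) (hn : ∀ i j, (d j : ℂ) * n i j - (d i : ℂ) * n j i = c i j - c' i j) :
    ∀ x ∈ deformedRelators a d c,
      toTopPresented (deformedRelators a d c') (freeTopLift (twistGen a d n) x) = 0 := by
  have hH : ∀ i, toTopPresented (deformedRelators a d c')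
      (freeTopLift (twistGen a d n) (genT (.cartan i))) =
      toTopPresented (deformedRelators a d c') (genT (.cartan i)) := fun i => by
    rw [freeTopLift_genT]; rfl
  have hE : ∀ i, toTopPresented (deformedRelators a d c')
      (freeTopLift (twistGen a d n) (genT (.pos i))) =
      toTopPresented (deformedRelators a d c') (genT (.pos i)) * weightExpComb a d c' (n i) :=
    fun i => by rw [freeTopLift_genT, twistGen, map_mul]; rfl
  have hF : ∀ i, toTopPresented (deformedRelators a d c')
      (freeTopLift (twistGen a d n) (genT (.neg i))) =
      weightExpComb a d c' (-n i) * toTopPresented (deformedRelators a d c') (genT (.neg i)) :=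
    fun i => by rw [freeTopLift_genT, twistGen, map_mul]; rfl
  have hrel : ∀ x, DeformedRelator a d c' x → toTopPresented (deformedRelators a d c') x = 0 :=
    fun x hx => toTopPresented_relator hx
  -- This puts the Serre coefficients in the form `b r * w ^ r` required by the twisting lemmas,
  -- with $w=q^y$.
  have hb : ∀ i j (r : ℕ) (y : ℂ), (-1) ^ r * qPow (r * y) * qBinom (d i) (1 - a i j).toNat r =
      (-1) ^ r * qBinom (d i) (1 - a i j).toNat r * qPow y ^ r := fun i j r y => by
    rw [qPow_nat_mul]; ring
  rintro x (⟨i, j⟩ | ⟨i, j⟩ | ⟨i, j⟩ | ⟨i, j⟩ | ⟨i, j, hij⟩ | ⟨i, j, hij⟩)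
  · simp only [map_sub, map_mul, hH]
    simpa only [map_sub, map_mul] using hrel _ (.cartan_cartan i j)
  · have h := hrel _ (.cartan_pos i j)
    simp only [map_sub, map_mul, map_zsmul] at h
    simp only [map_sub, map_mul, map_zsmul, hH, hE]
    rw [mul_assoc _ _ (toTopPresented _ (genT (.cartan i))), (weightExpComb_cartan _ i).eq,
      ← mul_assoc, ← mul_assoc, ← sub_mul, ← smul_mul_assoc, ← sub_mul, h, zero_mul]
  · have h := hrel _ (.cartan_neg i j)
    simp only [map_sub, map_add, map_mul, map_zsmul] at h
    simp only [map_sub, map_add, map_mul, map_zsmul, hH, hF]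
    rw [← mul_assoc, ← (weightExpComb_cartan _ i).eq, mul_assoc, mul_assoc, ← mul_sub,
      ← mul_smul_comm, ← mul_add, h, mul_zero]
  · have h := hrel _ (.pos_neg i j)
    simp only [map_sub, map_mul, toTopPresented_smul] at h
    simp only [map_sub, map_mul, freeTopLift_smul, toTopPresented_smul, hE, hF]
    -- Here `β` arises from moving $L^{n_i}$ to the right of $X_j^-$, and `γ` from moving $L^{-n_j}$
    -- to the left of $X_i^+$.
    rw [commutator_twist (β := qPow (-(d j * n i j))) (γ := qPow (d i * n j i))
      (v' := qPow (-c' i j)) (weightExpComb_neg ha _ j) ?_ (weightExpComb_commute _ _) ?_,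
      sub_eq_zero.1 h]
    · by_cases hij : i = j
      · subst hij
        have hc : c i i = c' i i := by
          have := hn i i
          rw [sub_self] at this
          exact (sub_eq_zero.1 this.symm)
        -- On the diagonal the factors `γ` and `β` are inverse, and $L^{-n_i}$ cancels $L^{n_i}$
        -- across the Cartan quotient, which commutes with both.
        rw [if_pos rfl, freeTopLift_twistGen_cartanQuotient, ← qPow_add, add_neg_cancel, qPow_zero,
          one_smul, (weightExpComb_cartanQuotient _ i).eq, mul_assoc, weightExpComb_mul,
          neg_add_cancel, weightExpComb_zero, mul_one, sub_self]
      · rw [if_neg hij, map_zero, map_zero, mul_zero, zero_mul, smul_zero, map_zero, sub_zero]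
    · have h1 := weightExpComb_pos (c := c') (d := d) ha (-n j) i
      rw [h1, smul_smul, ← qPow_add, Pi.neg_apply, mul_neg, add_neg_cancel, qPow_zero, one_smul]
    · rw [← qPow_add, ← qPow_add]
      congr 1
      linear_combination hn i j
  · have h := hrel _ (.serre_pos i j hij)
    simp only [map_sum, map_mul, map_pow, toTopPresented_smul, hb] at h
    simp only [map_sum, map_mul, map_pow, freeTopLift_smul, toTopPresented_smul, hE, hb]
    refine serre_sum_twist (weightExpComb_pos ha _ i) (weightExpComb_pos ha _ j)
      (weightExpComb_pos ha _ i) (weightExpComb_commute _ _) ?_ _ _ h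
    rw [← qPow_add, ← qPow_add]
    congr 1
    linear_combination -hn i j
  · have h := hrel _ (.serre_neg i j hij)
    simp only [map_sum, map_mul, map_pow, toTopPresented_smul, hb] at h
    simp only [map_sum, map_mul, map_pow, freeTopLift_smul, toTopPresented_smul, hF, hb]
    -- The sign of the exponent $-n_i$ and the sign in the exchange rule for $X_j^-$ cancel, so the
    -- powers of $q$ to be compared are those of the positive case.
    refine serre_sum_twist_left (weightExpComb_neg ha _ i) (weightExpComb_neg ha _ j)
      (weightExpComb_neg ha _ i) (weightExpComb_neg ha _ j) (weightExpComb_commute _ _) ?_ _ _ h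
    rw [← qPow_add, ← qPow_add]
    congr 1
    simp only [Pi.neg_apply]
    linear_combination -hn i j

open Classical in
/-- The twist by `n`, from the realization with parameters `c` to that with parameters `c'`. -/
def twistHom (ha : (a.map (Int.cast : ℤ → ℂ))⁻¹ * a.map (Int.cast : ℤ → ℂ) = 1)
    (n : ι → ι → ℂ) (hn : ∀ i j, (d j : ℂ) * n i j - (d i : ℂ) * n j i = c i j - c' i j) :
    DeformedQG a d c →ₐ[ℂ⟦X⟧] DeformedQG a d c' :=
  topLift _ _ (twistGen a d n) (twistGen_relator ha n hn)

open Classical in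
theorem twistHom_weightExpComb
    (ha : (a.map (Int.cast : ℤ → ℂ))⁻¹ * a.map (Int.cast : ℤ → ℂ) = 1)
    (n : ι → ι → ℂ) (hn : ∀ i j, (d j : ℂ) * n i j - (d i : ℂ) * n j i = c i j - c' i j)
    (z : ι → ℂ) : twistHom ha n hn (weightExpComb a d c z) = weightExpComb a d c' z := by
  rw [weightExpComb, twistHom, topLift_toTopPresented, freeTopLift_twistGen_expH, weightExpComb]

open Classical in
theorem twistHom_genT (ha : (a.map (Int.cast : ℤ → ℂ))⁻¹ * a.map (Int.cast : ℤ → ℂ) = 1)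
    (n : ι → ι → ℂ) (hn : ∀ i j, (d j : ℂ) * n i j - (d i : ℂ) * n j i = c i j - c' i j)
    (g : Gen ι) : twistHom ha n hn (toTopPresented _ (genT g)) =
      toTopPresented (deformedRelators a d c') (twistGen a d n g) := by
  rw [twistHom, topLift_toTopPresented, freeTopLift_genT]

open Classical in
-- The second twist leaves the exponentials introduced by the first unchanged, so the exponents add
-- up to $n+n'=0$ and the generators return to themselves.
theorem twistHom_comp_twistHom
    (ha : (a.map (Int.cast : ℤ → ℂ))⁻¹ * a.map (Int.cast : ℤ → ℂ) = 1)
    (n : ι → ι → ℂ) (hn : ∀ i j, (d j : ℂ) * n i j - (d i : ℂ) * n j i = c i j - c' i j)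
    (n' : ι → ι → ℂ) (hn' : ∀ i j, (d j : ℂ) * n' i j - (d i : ℂ) * n' j i = c' i j - c i j)
    (h : n + n' = 0) :
    (twistHom ha n' hn').comp (twistHom ha n hn) = AlgHom.id _ (DeformedQG a d c) := by
  have hi : ∀ i, n' i + n i = 0 := fun i => by
    rw [add_comm]
    exact congrFun h i
  refine topPresented_algHom_ext fun g => ?_
  rw [AlgHom.comp_apply, twistHom_genT]
  cases g with
  | cartan i => exact twistHom_genT ha n' hn' (.cartan i)
  | pos i =>
    rw [twistGen, map_mul, map_mul, twistHom_genT, twistGen, map_mul]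
    change _ * weightExpComb a d c (n' i) * twistHom ha n' hn' (weightExpComb a d c' (n i)) = _
    rw [twistHom_weightExpComb, mul_assoc, weightExpComb_mul, hi, weightExpComb_zero, mul_one]
    rfl
  | neg i =>
    rw [twistGen, map_mul, map_mul, twistHom_genT, twistGen, map_mul]
    change twistHom ha n' hn' (weightExpComb a d c' (-n i)) * (weightExpComb a d c (-n' i) * _) = _
    rw [twistHom_weightExpComb, ← mul_assoc, weightExpComb_mul, ← neg_add, add_comm, hi, neg_zero,
      weightExpComb_zero, one_mul]
    rfl

open Classical in
/-- The twist by `n`, as an isomorphism. -/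
def twistEquiv (ha : (a.map (Int.cast : ℤ → ℂ))⁻¹ * a.map (Int.cast : ℤ → ℂ) = 1)
    (n : ι → ι → ℂ) (hn : ∀ i j, (d j : ℂ) * n i j - (d i : ℂ) * n j i = c i j - c' i j) :
    DeformedQG a d c ≃ₐ[ℂ⟦X⟧] DeformedQG a d c' :=
  have hn' : ∀ i j, (d j : ℂ) * (-n) i j - (d i : ℂ) * (-n) j i = c' i j - c i j := fun i j => by
    simp only [Pi.neg_apply]
    linear_combination -hn i j
  AlgEquiv.ofAlgHom (twistHom ha n hn) (twistHom ha (-n) hn')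
    (twistHom_comp_twistHom ha _ _ _ _ (neg_add_cancel n))
    (twistHom_comp_twistHom ha _ _ _ _ (add_neg_cancel n))

theorem coeffHom_standard_weightGen_commute (p r : ι) :
    Commute (coeffHom {x | StandardRelator a d x} (weightGen a d p))
      (coeffHom {x | StandardRelator a d x} (weightGen a d r)) := by
  classical
  rw [standardRelators_eq]
  have h : ∀ p, weightGen a d p = weightComb a d (Pi.single p 1) := fun p => by
    simp [weightComb, Pi.single_apply]
  rw [h, h]
  exact coeffHom_weightComb_weightComb _ _

/-- The $Y_p$ commute modulo the relations, so a product of their exponentials is the exponential of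
the sum. This identifies the ordered-independent product of the statement with the single
exponential used in the twists. -/
theorem weightExpProd_eq (z : ι → ℂ) : weightExpProd a d z =
    toTopPresented {x | StandardRelator a d x} (expH (weightComb a d z)) := by
  classical
  have key : ∀ (s : Finset ι)
      (hs : (s : Set ι).Pairwise (Function.onFun Commute fun p => weightExp a d p (z p))),
      s.noncommProd (fun p => weightExp a d p (z p)) hs =
      toTopPresented {x | StandardRelator a d x} (expH (∑ p ∈ s, z p • weightGen a d p)) := by
    intro s hs
    induction s using Finset.induction_on with
    | empty => rw [Finset.noncommProd_empty, Finset.sum_empty, expH_zero, map_one]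
    | insert p s hp ih =>
      rw [Finset.noncommProd_insert_of_notMem _ _ _ _ hp, ih, Finset.sum_insert hp, weightExp,
        toTopPresented_expH_mul]
      rw [map_sum]
      refine Commute.sum_right _ _ _ fun r _ => ?_
      rw [map_smul, map_smul]
      exact ((coeffHom_standard_weightGen_commute p r).smul_left _).smul_right _
  exact key Finset.univ _

open Classical in
theorem exists_equiv_standardQG
    (ha : (a.map (Int.cast : ℤ → ℂ))⁻¹ * a.map (Int.cast : ℤ → ℂ) = 1)
    (n : ι → ι → ℂ) (hn : ∀ i j, (d j : ℂ) * n i j - (d i : ℂ) * n j i = c i j) :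
    ∃ ψ : DeformedQG a d c ≃ₐ[ℂ⟦X⟧] StandardQG a d,
      ∀ g, ψ (toTopPresented _ (genT g)) = toTopPresented _ (twistGen a d n g) := by
  unfold StandardQG
  rw [standardRelators_eq]
  have hn' : ∀ i j, (d j : ℂ) * n i j - (d i : ℂ) * n j i = c i j - (0 : ι → ι → ℂ) i j :=
    fun i j => by simp [hn]
  exact ⟨twistEquiv ha n hn', twistHom_genT ha n hn'⟩

end Realizations

/-! ### Specialization to the Cartan matrix of a simple Lie algebra -/

/-- The Cartan matrix of a base is nondegenerate over the integers, so its determinant stays nonzero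
in $\mathbb C$. Without this the matrix inverse would take its default value zero and the $Y_p$
would carry no information. -/
theorem cartan_inv_mul {𝔤 : Type*} [LieRing 𝔤] [LieAlgebra ℂ 𝔤] [FiniteDimensional ℂ 𝔤]
    [LieAlgebra.IsSimple ℂ 𝔤] {𝔥 : LieSubalgebra ℂ 𝔤} [𝔥.IsCartanSubalgebra]
    (b : (rootSystem 𝔥).Base) [DecidableEq b.support] :
    ((cartan b).map (Int.cast : ℤ → ℂ))⁻¹ * (cartan b).map (Int.cast : ℤ → ℂ) = 1 := by
  refine Matrix.nonsing_inv_mul _ ?_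
  have h := b.cartanMatrix_nondegenerate
  rw [Matrix.nondegenerate_iff_det_ne_zero] at h
  have hdet : ((cartan b).map (Int.cast : ℤ → ℂ)).det = ((cartan b).det : ℂ) :=
    ((Int.castRingHom ℂ).map_det (cartan b)).symm
  rw [hdet, isUnit_iff_ne_zero, cartan, Matrix.det_transpose]
  exact_mod_cast h

theorem LProd_eq {𝔤 : Type*} [LieRing 𝔤] [LieAlgebra ℂ 𝔤] [FiniteDimensional ℂ 𝔤]
    [LieAlgebra.IsSimple ℂ 𝔤] {𝔥 : LieSubalgebra ℂ 𝔤} [𝔥.IsCartanSubalgebra]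
    (b : (rootSystem 𝔥).Base) (d : b.support → ℕ) (z : b.support → ℂ) :
    LProd b d z = toTopPresented {x | StandardRelator (cartan b) d x}
      (expH (weightComb (cartan b) d z)) := weightExpProd_eq z

end QuantumRealization
end

theorem theorem4p1 {𝔤 : Type*} [LieRing 𝔤] [LieAlgebra ℂ 𝔤] [FiniteDimensional ℂ 𝔤]
    [LieAlgebra.IsSimple ℂ 𝔤] (𝔥 : LieSubalgebra ℂ 𝔤) [𝔥.IsCartanSubalgebra]
    (b : (LieAlgebra.IsKilling.rootSystem 𝔥).Base)
    (d : b.support → ℕ) (hd_pos : ∀ i, 0 < d i) (hd_coprime : Finset.univ.gcd d = 1)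
    (hd_symm : ∀ i j, (d i : ℤ) * QuantumRealization.cartan b i j =
      (d j : ℤ) * QuantumRealization.cartan b j i)
    (s : (LieAlgebra.IsKilling.rootSystem 𝔥).weylGroup)
    (n : b.support → b.support → ℂ)
    (hn : ∀ i j, (d j : ℂ) * n i j - (d i : ℂ) * n j i =
      QuantumRealization.cayleyCoeff b d s i j) :
    ∃! ψ : QuantumRealization.RealizationUhs b d s ≃ₐ[PowerSeries ℂ] QuantumRealization.Uh b d,
      (∀ i, ψ (QuantumRealization.e b d s i) =
        QuantumRealization.Xpos b d i * QuantumRealization.LProd b d (fun p => n i p)) ∧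
      (∀ i, ψ (QuantumRealization.f b d s i) =
        QuantumRealization.LProd b d (fun p => -n i p) * QuantumRealization.Xneg b d i) ∧
      (∀ i, ψ (QuantumRealization.Hs b d s i) = QuantumRealization.H b d i) := by
  classical
  open QuantumRealization in
  obtain ⟨ψ, hψ⟩ := exists_equiv_standardQG (c := cayleyCoeff b d s) (d := d)
    (by convert cartan_inv_mul b) n hn
  refine ⟨ψ, ⟨fun i => ?_, fun i => ?_, fun i => hψ (.cartan i)⟩, fun ψ' ⟨he, hf, hH⟩ => ?_⟩
  · rw [QuantumRealization.LProd_eq]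
    exact (hψ (.pos i)).trans (map_mul _ _ _)
  · rw [QuantumRealization.LProd_eq]
    exact (hψ (.neg i)).trans (map_mul _ _ _)
  · have h : ψ'.toAlgHom = ψ.toAlgHom := by
      refine QuantumRealization.topPresented_algHom_ext fun g => ?_
      refine Eq.trans ?_ (hψ g).symm
      cases g with
      | cartan i => exact hH i
      | pos i =>
        refine (he i).trans ?_
        rw [QuantumRealization.LProd_eq]
        exact (map_mul _ _ _).symm
      | neg i =>
        refine (hf i).trans ?_
        rw [QuantumRealization.LProd_eq]
        exact (map_mul _ _ _).symm
    exact AlgEquiv.ext fun x => DFunLike.congr_fun h x
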